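/- Let $p$ be a prime, $h\ge 0$, $G$ a finite (discrete) group, and let $X$ be a finite $G$-space, i.e. a topological space with continuous $G$-action that is $G$-homotopy equivalent to a finite $G$-CW complex. Let $\hom(\mathbb{Z}_p^h,G)$ be the set of continuous homomorphisms and write $\alpha\sim\beta$ if $\alpha,\beta$ are conjugate in $G$. For $\alpha,\beta\in\hom(\mathbb{Z}_p^h,G)$ put $C(\alpha,\beta)=\{g\in G : g\alpha g^{-1}=\beta\}$ and let $T(\alpha,\beta)$ be the quotient of $C(\alpha,\beta)\times\mathbb{Q}_p^h$ by the relation $(g,t+j)\sim(g\alpha(j),t)$ for $j\in\mathbb{Z}_p^h$, with the quotient topology (which is discrete). There are a composition $T(\beta,\delta)\times T(\alpha,\beta)\to T(\alpha,\delta)$, $([k,s],[g,t])\mapsto[kg,s+t]$, with identities $[e,0]\in T(\alpha,\alpha)$, and maps $T(\alpha,\beta)\times X^{\operatorname{im}\alpha}\to X^{\operatorname{im}\beta}$, $([g,t],x)\mapsto gx$. In particular $T(\alpha)=T(\alpha,\alpha)$ is a group acting on $X^{\operatorname{im}\alpha}$. Define $$\mathrm{Twist}_h(X)=\coprod_{[\alpha]\in\hom(\mathbb{Z}_p^h,G)/\sim}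 ET(\alpha)\times_{T(\alpha)}X^{\operatorname{im}\alpha},$$ where one representative $\alpha$ is chosen in each conjugacy class and $ET(\alpha)$ is the geometric realization of the simplicial space $[n]\mapsto T(\alpha)^{n+1}$. Let $\mathrm{Twist}_h^{gpd}(X)$ be the geometric realization of the nerve of the topological groupoid with object space $\coprod_{\alpha}X^{\operatorname{im}\alpha}$ and morphism space $\coprod_{(\alpha,\beta)}T(\alpha,\beta)\times X^{\operatorname{im}\alpha}$, where $([g,t],x)$ has domain $x\in X^{\operatorname{im}\alpha}$ and codomain $gx\in X^{\operatorname{im}\beta}$, and composition is induced by that of the $T(\alpha,\beta)$. Then, for every choice of representatives of the conjugacy classes, $\mathrm{Twist}_h(X)$ and $\mathrm{Twist}_h^{gpd}(X)$ are homotopy equivalent. -/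

import Mathlib

namespace TwistSpace

open CategoryTheory Opposite

noncomputable section

/-! ### Geometric realization of simplicial spaces -/

section Realization

universe w w'

/-- The points of `∐ₙ Sₙ × Δⁿ`. -/
abbrev PreRealization (S : SimplicialObject TopCat.{w}) : Type w :=
  Σ n : SimplexCategory, S.obj (op n) × stdSimplex ℝ (Fin (n.len + 1))

/-- The gluing relation `(θ^* x, u) ~ (x, θ_* u)`. -/
inductive RealizationRel (S : SimplicialObject TopCat.{w}) :
    PreRealization S → PreRealization S → Prop
  | glue {m n : SimplexCategory} (θ : m ⟶ n) (x : S.obj (op n))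
      (u : stdSimplex ℝ (Fin (m.len + 1))) :
      RealizationRel S ⟨m, (S.map θ.op x, u)⟩ ⟨n, (x, stdSimplex.map θ.toOrderHom u)⟩

/-- The geometric realization of a simplicial space: the quotient space of `∐ₙ Sₙ × Δⁿ` by the
equivalence relation generated by `(θ^* x, u) ~ (x, θ_* u)`. -/
def Realization (S : SimplicialObject TopCat.{w}) : Type w := Quot (RealizationRel S)

instance (S : SimplicialObject TopCat.{w}) : TopologicalSpace (Realization S) :=
  inferInstanceAs (TopologicalSpace (Quot (RealizationRel S)))

/-! ### Topological groupoids and their nerves -/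

/-- A topological groupoid (a groupoid object in topological spaces).
`comp f g` is `f` followed by `g`. -/
structure TopGroupoid where
  Obj : Type w
  Mor : Type w
  [topObj : TopologicalSpace Obj]
  [topMor : TopologicalSpace Mor]
  dom : Mor → Obj
  cod : Mor → Obj
  one : Obj → Mor
  comp (f g : Mor) (e : cod f = dom g) : Mor
  inv : Mor → Mor
  dom_one (x : Obj) : dom (one x) = x
  cod_one (x : Obj) : cod (one x) = x
  dom_comp (f g : Mor) (e : cod f = dom g) : dom (comp f g e) = dom f
  cod_comp (f g : Mor) (e : cod f = dom g) : cod (comp f g e) = cod g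
  dom_inv (f : Mor) : dom (inv f) = cod f
  cod_inv (f : Mor) : cod (inv f) = dom f
  one_comp (f : Mor) : comp (one (dom f)) f (cod_one _) = f
  comp_one (f : Mor) : comp f (one (cod f)) (dom_one _).symm = f
  assoc (f g k : Mor) (e : cod f = dom g) (e' : cod g = dom k) :
    comp (comp f g e) k ((cod_comp f g e).trans e') =
      comp f (comp g k e') (e.trans (dom_comp g k e').symm)
  comp_inv (f : Mor) : comp f (inv f) (dom_inv f).symm = one (dom f)
  inv_comp (f : Mor) : comp (inv f) f (cod_inv f) = one (cod f)
  continuous_dom : Continuous dom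
  continuous_cod : Continuous cod
  continuous_one : Continuous one
  continuous_comp : Continuous
    fun q : {q : Mor × Mor // cod q.1 = dom q.2} => comp q.1.1 q.1.2 q.2
  continuous_inv : Continuous inv

attribute [instance] TopGroupoid.topObj TopGroupoid.topMor

/-- The space of functors from a preorder `I` to a topological groupoid `𝒢`, as a subspace of
`∏_{i} Obj × ∏_{i ≤ j} Mor`. For `I = {0 < ⋯ < n}` evaluation at the arrows `i ≤ i + 1` is a
homeomorphism onto the space of composable chains of `n` morphisms. -/
def NerveSimplex (𝒢 : TopGroupoid.{w}) (I : Type) [Preorder I] : Type w :=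
  {F : (I → 𝒢.Obj) × ({q : I × I // q.1 ≤ q.2} → 𝒢.Mor) //
    (∀ q, 𝒢.dom (F.2 q) = F.1 q.1.1) ∧ (∀ q, 𝒢.cod (F.2 q) = F.1 q.1.2) ∧
    (∀ i, F.2 ⟨(i, i), le_refl i⟩ = 𝒢.one (F.1 i)) ∧
    ∀ (i j k : I) (hij : i ≤ j) (hjk : j ≤ k)
      (e : 𝒢.cod (F.2 ⟨(i, j), hij⟩) = 𝒢.dom (F.2 ⟨(j, k), hjk⟩)),
      𝒢.comp (F.2 ⟨(i, j), hij⟩) (F.2 ⟨(j, k), hjk⟩) e = F.2 ⟨(i, k), hij.trans hjk⟩}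

instance (𝒢 : TopGroupoid.{w}) (I : Type) [Preorder I] :
    TopologicalSpace (NerveSimplex 𝒢 I) :=
  inferInstanceAs (TopologicalSpace (Subtype _))

/-- Precomposition of functors with a monotone map. -/
def NerveSimplex.pull (𝒢 : TopGroupoid.{w}) {I J : Type} [Preorder I] [Preorder J]
    (θ : I →o J) : C(NerveSimplex 𝒢 J, NerveSimplex 𝒢 I) where
  toFun F := ⟨(fun i => F.1.1 (θ i), fun q => F.1.2 ⟨(θ q.1.1, θ q.1.2), θ.monotone q.2⟩),
    fun q => F.2.1 _, fun q => F.2.2.1 _, fun i => F.2.2.2.1 _,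
    fun i j k hij hjk e => F.2.2.2.2 _ _ _ _ _ e⟩
  continuous_toFun := by
    refine Continuous.subtype_mk (Continuous.prodMk ?_ ?_) _
    · exact continuous_pi fun i =>
        (continuous_apply (θ i)).comp (continuous_fst.comp continuous_subtype_val)
    · exact continuous_pi fun q =>
        (continuous_apply (⟨(θ q.1.1, θ q.1.2), θ.monotone q.2⟩ : {q : J × J // q.1 ≤ q.2})).comp
          (continuous_snd.comp continuous_subtype_val)

/-- The nerve of a topological groupoid, a simplicial space. -/
def nerve (𝒢 : TopGroupoid.{w}) : SimplicialObject TopCat.{w} where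
  obj n := TopCat.of (NerveSimplex 𝒢 (Fin (n.unop.len + 1)))
  map θ := TopCat.ofHom (NerveSimplex.pull 𝒢 θ.unop.toOrderHom)
  map_id _ := rfl
  map_comp _ _ := rfl

/-! ### The universal space `EΓ` and the Borel construction -/

/-- The simplicial space `[n] ↦ Γⁿ⁺¹`. -/
def simplicialE (Γ : Type w) [TopologicalSpace Γ] : SimplicialObject TopCat.{w} where
  obj n := TopCat.of (Fin (n.unop.len + 1) → Γ)
  map θ := TopCat.ofHom ⟨fun f i => f (θ.unop.toOrderHom i), by fun_prop⟩
  map_id _ := rfl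
  map_comp _ _ := rfl

/-- The universal `Γ`-space `EΓ`, the realization of `[n] ↦ Γⁿ⁺¹`. -/
def E (Γ : Type w) [TopologicalSpace Γ] : Type w := Realization (simplicialE Γ)

instance (Γ : Type w) [TopologicalSpace Γ] : TopologicalSpace (E Γ) :=
  inferInstanceAs (TopologicalSpace (Realization (simplicialE Γ)))

/-- The left translation action of `Γ` on `EΓ`. -/
instance (Γ : Type w) [TopologicalSpace Γ] [Group Γ] : MulAction Γ (E Γ) where
  smul t := Quot.map (fun a => ⟨a.1, ((fun i => t * (a.2.1 : Fin (a.1.len + 1) → Γ) i :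
      Fin (a.1.len + 1) → Γ), a.2.2)⟩) (by
    rintro _ _ ⟨θ, x, u⟩
    exact RealizationRel.glue (S := simplicialE Γ) θ
      (fun i => t * (x : Fin (_ + 1) → Γ) i : Fin (_ + 1) → Γ) u)
  one_smul := by
    rintro ⟨⟨n, f, u⟩⟩
    refine congrArg (fun f' : Fin (n.len + 1) → Γ =>
      Quot.mk (RealizationRel (simplicialE Γ)) ⟨n, (f', u)⟩) (a₂ := f) ?_
    funext i
    exact one_mul _
  mul_smul := by
    rintro s t ⟨⟨n, f, u⟩⟩
    refine congrArg (fun f' : Fin (n.len + 1) → Γ =>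
      Quot.mk (RealizationRel (simplicialE Γ)) ⟨n, (f', u)⟩) ?_
    funext i
    exact mul_assoc _ _ _

/-- The Borel construction `EΓ ×_Γ Y`: the orbit space of the diagonal action on `EΓ × Y`. -/
def Borel (Γ : Type w) [TopologicalSpace Γ] [Group Γ] (Y : Type w') [TopologicalSpace Y]
    [MulAction Γ Y] : Type (max w w') :=
  MulAction.orbitRel.Quotient Γ (E Γ × Y)

instance (Γ : Type w) [TopologicalSpace Γ] [Group Γ] (Y : Type w') [TopologicalSpace Y]
    [MulAction Γ Y] : TopologicalSpace (Borel Γ Y) :=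
  inferInstanceAs (TopologicalSpace (Quotient (MulAction.orbitRel Γ (E Γ × Y))))

end Realization

/-! ### Finite `G`-spaces -/

section FiniteGSpace

universe u v

/-- `Y` is a finite `G`-CW complex (`G` a finite discrete group): a Hausdorff finite CW complex
on which each group element permutes the open cells of each dimension, and acts as the identity
on every open cell that it maps to itself. The orbits of cells are the equivariant cells
`G/H × Dⁿ`. -/
def IsFiniteGCWComplex (G : Type u) [Group G] (Y : Type v) [TopologicalSpace Y]
    [MulAction G Y] : Prop :=
  T2Space Y ∧ (∀ g : G, Continuous fun y : Y => g • y) ∧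
  ∃ _ : Topology.CWComplex (Set.univ : Set Y),
    Finite (Σ n, Topology.RelCWComplex.cell (Set.univ : Set Y) n) ∧
    (∀ (g : G) (n : ℕ) (i : Topology.RelCWComplex.cell (Set.univ : Set Y) n),
      ∃ j : Topology.RelCWComplex.cell (Set.univ : Set Y) n,
        (fun y : Y => g • y) '' Topology.RelCWComplex.openCell n i = Topology.RelCWComplex.openCell n j) ∧
    (∀ (g : G) (n : ℕ) (i : Topology.RelCWComplex.cell (Set.univ : Set Y) n),
      (fun y : Y => g • y) '' Topology.RelCWComplex.openCell n i = Topology.RelCWComplex.openCell n i →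
      ∀ y ∈ Topology.RelCWComplex.openCell (C := (Set.univ : Set Y)) n i, g • y = y)

/-- `X` and `Y` are `G`-homotopy equivalent. -/
def GHomotopyEquivalent (G : Type u) [Group G] (X Y : Type v) [TopologicalSpace X]
    [MulAction G X] [TopologicalSpace Y] [MulAction G Y] : Prop :=
  ∃ (f : C(X, Y)) (k : C(Y, X)) (F : (k.comp f).Homotopy (ContinuousMap.id X))
    (K : (f.comp k).Homotopy (ContinuousMap.id Y)),
    (∀ (g : G) (x : X), f (g • x) = g • f x) ∧
    (∀ (g : G) (y : Y), k (g • y) = g • k y) ∧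
    (∀ (g : G) (s : unitInterval) (x : X), F (s, g • x) = g • F (s, x)) ∧
    (∀ (g : G) (s : unitInterval) (y : Y), K (s, g • y) = g • K (s, y))

/-- A finite `G`-space: a `G`-space that is `G`-homotopy equivalent to a finite `G`-CW complex. -/
def IsFiniteGSpace (G : Type u) [Group G] (X : Type v) [TopologicalSpace X]
    [MulAction G X] : Prop :=
  ∃ (Y : Type v) (_ : TopologicalSpace Y) (_ : MulAction G Y),
    IsFiniteGCWComplex G Y ∧ GHomotopyEquivalent G X Y

end FiniteGSpace

/-! ### The groups `T(α)` and the spaces `T(α, β)` -/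

section Twist

universe u v

variable {p : ℕ} [Fact p.Prime] {h : ℕ} {G : Type u} [Group G] [TopologicalSpace G]

/-- Continuous homomorphisms `ℤ_p^h → G`. -/
abbrev ZpHom (p : ℕ) [Fact p.Prime] (h : ℕ) (G : Type u) [Group G] [TopologicalSpace G] :
    Type u :=
  Multiplicative (Fin h → ℤ_[p]) →ₜ* G

/-- `C(α, β) = {g ∈ G | g α g⁻¹ = β}`. -/
def transporter (α β : ZpHom p h G) : Set G := {g | ∀ z, g * α z * g⁻¹ = β z}

/-- Two homomorphisms are equivalent if they are conjugate. -/
def conjSetoid (p : ℕ) [Fact p.Prime] (h : ℕ) (G : Type u) [Group G] [TopologicalSpace G] :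
    Setoid (ZpHom p h G) where
  r α β := ∃ g : G, ∀ z, g * α z * g⁻¹ = β z
  iseqv :=
    { refl := fun α => ⟨1, fun z => by simp⟩
      symm := by
        rintro α β ⟨g, hg⟩
        exact ⟨g⁻¹, fun z => by rw [← hg z]; group⟩
      trans := by
        rintro α β γ ⟨g, hg⟩ ⟨k, hk⟩
        exact ⟨k * g, fun z => by rw [← hk z, ← hg z]; group⟩ }

/-- The set `hom(ℤ_p^h, G)/∼` of conjugacy classes. -/
abbrev ConjClass (p : ℕ) [Fact p.Prime] (h : ℕ) (G : Type u) [Group G] [TopologicalSpace G] :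
    Type u :=
  Quotient (conjSetoid p h G)

/-- The inclusion `ℤ_p^h → ℚ_p^h`. -/
def incl (j : Fin h → ℤ_[p]) : Fin h → ℚ_[p] := fun i => (j i : ℚ_[p])

lemma incl_add (j k : Fin h → ℤ_[p]) : incl (j + k) = incl j + incl k := by
  funext i; simp [incl]

lemma incl_neg (j : Fin h → ℤ_[p]) : incl (-j) = -incl j := by
  funext i; simp [incl]

lemma incl_zero : incl (0 : Fin h → ℤ_[p]) = 0 := by
  funext i; simp [incl]

/-- For `g ∈ C(α, β)`: `g α(z) = β(z) g`. -/
lemma transporter_comm {α β : ZpHom p h G} {g : G} (hg : g ∈ transporter α β)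
    (z : Multiplicative (Fin h → ℤ_[p])) : g * α z = β z * g := by
  rw [← hg z]; group

/-- The relation `(g, t + j) ∼ (g α(j), t)`, for `j ∈ ℤ_p^h`, on `C(α, β) × ℚ_p^h`. -/
def twistSetoid (α β : ZpHom p h G) : Setoid (transporter α β × (Fin h → ℚ_[p])) where
  r a b := ∃ j : Fin h → ℤ_[p],
    (b.1 : G) = a.1 * α (Multiplicative.ofAdd j) ∧ a.2 = b.2 + incl j
  iseqv :=
    { refl := fun a => ⟨0, by simp, by simp [incl_zero]⟩
      symm := by
        rintro a b ⟨j, h1, h2⟩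
        refine ⟨-j, ?_, ?_⟩
        · rw [h1, mul_assoc, ← map_mul, ← ofAdd_add]; simp
        · rw [h2, incl_neg]; simp
      trans := by
        rintro a b c ⟨j, h1, h2⟩ ⟨k, h3, h4⟩
        refine ⟨j + k, ?_, ?_⟩
        · rw [h3, h1, mul_assoc, ← map_mul, ← ofAdd_add]
        · rw [h2, h4, incl_add, add_assoc, add_comm (incl k)] }

/-- `T(α, β)`: the coequalizer of the two actions of `ℤ_p^h` on `C(α, β) × ℚ_p^h`, with the
quotient topology (`G` being discrete, it is a discrete space). -/
def T (α β : ZpHom p h G) : Type u := Quotient (twistSetoid α β)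

instance (α β : ZpHom p h G) : TopologicalSpace (T α β) :=
  inferInstanceAs (TopologicalSpace (Quotient (twistSetoid α β)))

/-- The class `[g, t]`. -/
def T.mk {α β : ZpHom p h G} (g : transporter α β) (t : Fin h → ℚ_[p]) : T α β :=
  Quotient.mk (twistSetoid α β) (g, t)

lemma T.ind {α β : ZpHom p h G} {P : T α β → Prop} (H : ∀ g t, P (T.mk g t)) (τ : T α β) :
    P τ := Quotient.ind (fun a => H a.1 a.2) τ

lemma T.mk_eq_mk {α β : ZpHom p h G} {g g' : transporter α β} {t t' : Fin h → ℚ_[p]}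
    (hg : (g : G) = g') (ht : t = t') : T.mk g t = T.mk g' t' := by
  rw [Subtype.ext hg, ht]

/-- The identity `[e, 0]`. -/
def T.one (α : ZpHom p h G) : T α α := T.mk ⟨1, fun z => by simp⟩ 0

/-- The composition `T(β, δ) × T(α, β) → T(α, δ)`, `([k, s], [g, t]) ↦ [kg, s + t]`. -/
def T.comp {α β β' δ : ZpHom p h G} (e : β = β') : T β' δ → T α β → T α δ :=
  Quotient.map₂ (fun a b => (⟨a.1 * b.1, fun z => by
      have h1 := a.1.2 z
      have h2 := b.1.2 z
      rw [← h1, ← DFunLike.congr_fun e z, ← h2]; group⟩, a.2 + b.2)) (by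
    subst e
    rintro ⟨⟨a, ha⟩, s⟩ ⟨⟨a', ha'⟩, s'⟩ ⟨j, h1, h2⟩ ⟨⟨b, hb⟩, t⟩ ⟨⟨b', hb'⟩, t'⟩ ⟨k, h3, h4⟩
    simp only at h1 h2 h3 h4
    refine ⟨j + k, ?_, ?_⟩
    · simp only [h1, h3, ofAdd_add, map_mul]
      have := transporter_comm hb (Multiplicative.ofAdd j)
      calc a * β (Multiplicative.ofAdd j) * (b * α (Multiplicative.ofAdd k))
          = a * (β (Multiplicative.ofAdd j) * b) * α (Multiplicative.ofAdd k) := by group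
        _ = a * b * (α (Multiplicative.ofAdd j) * α (Multiplicative.ofAdd k)) := by
          rw [← this]; group
    · simp only [h2, h4, incl_add]; abel)

/-- The inverse `[g, t] ↦ [g⁻¹, -t]`. -/
def T.inv {α β : ZpHom p h G} : T α β → T β α :=
  Quotient.map (fun a => (⟨(a.1 : G)⁻¹, fun z => by
      have h1 := a.1.2 z
      rw [← h1]; group⟩, -a.2)) (by
    rintro ⟨⟨a, ha⟩, s⟩ ⟨⟨a', ha'⟩, s'⟩ ⟨j, h1, h2⟩
    simp only at h1 h2
    refine ⟨-j, ?_, ?_⟩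
    · have := transporter_comm ha (Multiplicative.ofAdd j)
      simp only [h1, ofAdd_neg, map_inv]
      rw [this]; group
    · simp only [h2, incl_neg]; abel)

lemma T.one_comp {α β : ZpHom p h G} (τ : T α β) :
    T.comp rfl (T.one β) τ = τ ∧ T.comp rfl τ (T.one α) = τ := by
  induction τ using T.ind
  exact ⟨T.mk_eq_mk (one_mul _) (zero_add _), T.mk_eq_mk (mul_one _) (add_zero _)⟩

lemma T.comp_assoc {α β β' γ γ' δ : ZpHom p h G} (e : β = β') (e' : γ = γ')
    (τ₁ : T α β) (τ₂ : T β' γ) (τ₃ : T γ' δ) :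
    T.comp e' τ₃ (T.comp e τ₂ τ₁) = T.comp e (T.comp e' τ₃ τ₂) τ₁ := by
  induction τ₁ using T.ind
  induction τ₂ using T.ind
  induction τ₃ using T.ind
  exact T.mk_eq_mk (mul_assoc _ _ _).symm (add_assoc _ _ _).symm

lemma T.inv_comp {α β : ZpHom p h G} (τ : T α β) :
    T.comp rfl (T.inv τ) τ = T.one α ∧ T.comp rfl τ (T.inv τ) = T.one β := by
  induction τ using T.ind
  exact ⟨T.mk_eq_mk (inv_mul_cancel _) (neg_add_cancel _),
    T.mk_eq_mk (mul_inv_cancel _) (add_neg_cancel _)⟩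

/-- The group structure on `T(α) = T(α, α)`, which is `C(im α) ⊕_{ℤ_p^h} ℚ_p^h`. -/
instance (α : ZpHom p h G) : Group (T α α) where
  mul a b := T.comp rfl a b
  one := T.one α
  inv := T.inv
  mul_assoc a b c := (T.comp_assoc rfl rfl c b a).symm
  one_mul a := (T.one_comp a).1
  mul_one a := (T.one_comp a).2
  inv_mul_cancel a := (T.inv_comp a).1

/-- `X^{im α}`. -/
def fixed (α : ZpHom p h G) (X : Type v) [MulAction G X] : Set X := {x | ∀ z, α z • x = x}

variable {X : Type v} [MulAction G X]

/-- The map `T(α, β) × X^{im α} → X^{im β}`, `[g, t] x = g x`. -/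
def T.act {α β : ZpHom p h G} (τ : T α β) (x : fixed α X) : fixed β X :=
  Quotient.lift (s := twistSetoid α β) (fun a => (⟨(a.1 : G) • (x : X), fun z => by
      rw [smul_smul, ← transporter_comm a.1.2 z, mul_smul, x.2 z]⟩ : fixed β X)) (by
    rintro ⟨⟨a, ha⟩, s⟩ ⟨⟨a', ha'⟩, s'⟩ ⟨j, h1, h2⟩
    simp only at h1
    refine Subtype.ext ?_
    simp only [h1, mul_smul]
    rw [x.2]) τ

lemma T.act_one {α : ZpHom p h G} (x : fixed α X) : T.act (T.one α) x = x :=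
  Subtype.ext (one_smul G (x : X))

lemma T.act_comp {α β δ : ZpHom p h G} (σ : T β δ) (τ : T α β) (x : fixed α X) :
    T.act (T.comp rfl σ τ) x = T.act σ (T.act τ x) := by
  induction σ using T.ind
  induction τ using T.ind
  exact Subtype.ext (mul_smul _ _ (x : X))

/-- The action of `T(α)` on `X^{im α}`. -/
instance (α : ZpHom p h G) : MulAction (T α α) (fixed α X) where
  smul τ x := T.act τ x
  one_smul x := T.act_one x
  mul_smul σ τ x := T.act_comp σ τ x

/-- `Twist_h(X) = ∐_{[α]} ET(α) ×_{T(α)} X^{im α}`, computed with representatives `r c` of the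
conjugacy classes `c`. -/
def Twist (r : ConjClass p h G → ZpHom p h G) (X : Type v) [TopologicalSpace X]
    [MulAction G X] : Type (max u v) :=
  Σ c : ConjClass p h G, Borel (T (r c) (r c)) (fixed (r c) X)

instance (r : ConjClass p h G → ZpHom p h G) (X : Type v) [TopologicalSpace X]
    [MulAction G X] : TopologicalSpace (Twist r X) :=
  inferInstanceAs (TopologicalSpace
    (Σ c : ConjClass p h G, Borel (T (r c) (r c)) (fixed (r c) X)))

/-! ### The topological groupoid of all homomorphisms -/

/-- The object space `∐_α X^{im α}`. -/
abbrev TwistObj (p : ℕ) [Fact p.Prime] (h : ℕ) (G : Type u) [Group G] [TopologicalSpace G]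
    (X : Type v) [MulAction G X] : Type (max u v) :=
  Σ α : ZpHom p h G, fixed α X

/-- The morphism space `∐_{(α, β)} T(α, β) × X^{im α}`. -/
abbrev TwistMor (p : ℕ) [Fact p.Prime] (h : ℕ) (G : Type u) [Group G] [TopologicalSpace G]
    (X : Type v) [MulAction G X] : Type (max u v) :=
  Σ ab : ZpHom p h G × ZpHom p h G, T ab.1 ab.2 × fixed ab.1 X

/-- The domain map, the projection. -/
def TwistMor.dom (m : TwistMor p h G X) : TwistObj p h G X := ⟨m.1.1, m.2.2⟩

/-- The codomain map, given by the action. -/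
def TwistMor.cod (m : TwistMor p h G X) : TwistObj p h G X := ⟨m.1.2, T.act m.2.1 m.2.2⟩

/-- Composition, `m` followed by `m'`. -/
def TwistMor.comp (m m' : TwistMor p h G X) (e : TwistMor.cod m = TwistMor.dom m') :
    TwistMor p h G X :=
  ⟨(m.1.1, m'.1.2), (T.comp (congrArg Sigma.fst e) m'.2.1 m.2.1, m.2.2)⟩

lemma TwistMor.cod_comp (m m' : TwistMor p h G X) (e : TwistMor.cod m = TwistMor.dom m') :
    TwistMor.cod (TwistMor.comp m m' e) = TwistMor.cod m' := by
  obtain ⟨⟨α, β⟩, τ, x⟩ := m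
  obtain ⟨⟨β', δ⟩, σ, y⟩ := m'
  obtain rfl : β = β' := congrArg Sigma.fst e
  obtain rfl : T.act τ x = y := eq_of_heq (Sigma.mk.inj e).2
  exact congrArg (Sigma.mk δ) (T.act_comp σ τ x)

/-- The inverse of a morphism. -/
def TwistMor.inv (m : TwistMor p h G X) : TwistMor p h G X :=
  ⟨(m.1.2, m.1.1), (T.inv m.2.1, T.act m.2.1 m.2.2)⟩

instance [DiscreteTopology G] (α β : ZpHom p h G) : DiscreteTopology (T α β) := by
  rw [discreteTopology_iff_isOpen_singleton]
  intro τ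
  have hq : Topology.IsQuotientMap
      (fun a : transporter α β × (Fin h → ℚ_[p]) => T.mk a.1 a.2) :=
    isQuotientMap_quotient_mk'
  rw [← hq.isOpen_preimage, isOpen_iff_mem_nhds]
  rintro ⟨g, t⟩ hgt
  have hker : IsOpen {j : Fin h → ℤ_[p] | α (Multiplicative.ofAdd j) = 1} :=
    (isOpen_discrete ({1} : Set G)).preimage
      (α.continuous_toFun.comp (continuous_ofAdd (X := Fin h → ℤ_[p])))
  have hincl : IsOpenMap (incl : (Fin h → ℤ_[p]) → Fin h → ℚ_[p]) :=
    IsOpenMap.piMap (fun _ => PadicInt.isOpenEmbedding_coe.isOpenMap)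
      (by simp)
  have hU : IsOpen ((fun s => s - t) ⁻¹'
      (incl '' {j : Fin h → ℤ_[p] | α (Multiplicative.ofAdd j) = 1})) :=
    (hincl _ hker).preimage (by fun_prop)
  have hV := (isOpen_discrete ({g} : Set (transporter α β))).prod hU
  refine Filter.mem_of_superset (hV.mem_nhds ⟨rfl, 0, by simp, by simp [incl_zero]⟩) ?_
  rintro ⟨g', s⟩ ⟨hg', j, hj, hjs⟩
  obtain rfl : g' = g := hg'
  have : Quotient.mk (twistSetoid α β) (g', s) = Quotient.mk (twistSetoid α β) (g', t) :=
    Quotient.sound ⟨j, by simp [show α (Multiplicative.ofAdd j) = 1 from hj], by simp [hjs]⟩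
  exact this.trans hgt

section Continuity

variable [TopologicalSpace X]

/-- The discrete part of a morphism. -/
def TwistMor.label (m : TwistMor p h G X) : Σ ab : ZpHom p h G × ZpHom p h G, T ab.1 ab.2 :=
  ⟨m.1, m.2.1⟩

lemma TwistMor.continuous_label : Continuous (TwistMor.label (p := p) (h := h) (G := G) (X := X)) :=
  continuous_sigma fun _ => continuous_sigmaMk.comp continuous_fst

lemma TwistMor.continuous_pt :
    Continuous (fun m : TwistMor p h G X => (m.2.2 : X)) :=
  continuous_sigma fun _ => continuous_subtype_val.comp continuous_snd

variable [DiscreteTopology G]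

lemma TwistMor.continuous_mk {Z : Type*} [TopologicalSpace Z] {F : Z → TwistMor p h G X}
    (hl : Continuous fun z => TwistMor.label (F z)) (hp : Continuous fun z => ((F z).2.2 : X)) :
    Continuous F := by
  rw [continuous_iff_continuousAt]
  intro z₀
  set l := TwistMor.label (F z₀) with hl₀
  have hU : IsOpen ((fun z => TwistMor.label (F z)) ⁻¹' {l}) := (isOpen_discrete _).preimage hl
  have key : ∀ m : TwistMor p h G X, TwistMor.label m = l → (m.2.2 : X) ∈ fixed l.1.1 X := by
    rintro m hm
    rw [← hm]
    exact m.2.2.2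
  rw [← hU.isOpenEmbedding_subtypeVal.continuousAt_iff (x := ⟨z₀, rfl⟩)]
  apply Continuous.continuousAt
  have : F ∘ (Subtype.val : (fun z => TwistMor.label (F z)) ⁻¹' {l} → Z) =
      fun z => (⟨l.1, (l.2, ⟨((F z.1).2.2 : X), key _ z.2⟩)⟩ : TwistMor p h G X) := by
    funext z
    obtain ⟨z, hz⟩ := z
    have aux : ∀ (m : TwistMor p h G X) (hm : TwistMor.label m = l),
        m = ⟨l.1, (l.2, ⟨(m.2.2 : X), key _ hm⟩)⟩ := by
      intro m
      generalize l = l' at key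
      rintro rfl
      rfl
    exact aux (F z) hz
  rw [this]
  exact continuous_sigmaMk.comp (continuous_const.prodMk
    ((hp.comp continuous_subtype_val).subtype_mk _))

variable [ContinuousSMul G X]

lemma TwistMor.continuous_cod : Continuous (TwistMor.cod (p := p) (h := h) (G := G) (X := X)) := by
  refine continuous_sigma fun ab => ?_
  refine continuous_prod_of_discrete_left.mpr fun τ => ?_
  induction τ using T.ind with
  | H g t =>
    have : Continuous fun x : fixed ab.1 X => T.act (T.mk g t) x :=
      Continuous.subtype_mk (f := fun x : fixed ab.1 X => (g : G) • (x : X))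
        ((continuous_const_smul (g : G)).comp continuous_subtype_val)
        fun x => (T.act (T.mk g t) x).2
    exact (continuous_sigmaMk (σ := fun α : ZpHom p h G => fixed α X) (i := ab.2)).comp this

/-- The topological groupoid with objects `∐_α X^{im α}` and morphisms
`∐_{(α, β)} T(α, β) × X^{im α}`. -/
def twistGroupoid (p : ℕ) [Fact p.Prime] (h : ℕ) (G : Type u) [Group G] [TopologicalSpace G]
    [DiscreteTopology G] (X : Type v) [TopologicalSpace X] [MulAction G X]
    [ContinuousSMul G X] : TopGroupoid.{max u v} where
  Obj := TwistObj p h G X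
  Mor := TwistMor p h G X
  dom := TwistMor.dom
  cod := TwistMor.cod
  one x := ⟨(x.1, x.1), (T.one x.1, x.2)⟩
  comp := TwistMor.comp
  inv := TwistMor.inv
  dom_one _ := rfl
  cod_one x := congrArg (Sigma.mk x.1) (T.act_one x.2)
  dom_comp _ _ _ := rfl
  cod_comp := TwistMor.cod_comp
  dom_inv _ := rfl
  cod_inv m := congrArg (Sigma.mk m.1.1) (by
    change T.act (T.inv m.2.1) (T.act m.2.1 m.2.2) = m.2.2
    rw [← T.act_comp, (T.inv_comp _).1, T.act_one])
  one_comp m := congrArg (fun τ => (⟨m.1, (τ, m.2.2)⟩ : TwistMor p h G X))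
    (T.one_comp m.2.1).2
  comp_one m := congrArg (fun τ => (⟨m.1, (τ, m.2.2)⟩ : TwistMor p h G X))
    (T.one_comp m.2.1).1
  assoc f g k e e' := congrArg
    (fun τ => (⟨(f.1.1, k.1.2), (τ, f.2.2)⟩ : TwistMor p h G X))
    (T.comp_assoc (congrArg Sigma.fst e) (congrArg Sigma.fst e') f.2.1 g.2.1 k.2.1)
  comp_inv m := congrArg (fun τ => (⟨(m.1.1, m.1.1), (τ, m.2.2)⟩ : TwistMor p h G X))
    (T.inv_comp m.2.1).1
  inv_comp m := congrArg
    (fun τ => (⟨(m.1.2, m.1.2), (τ, T.act m.2.1 m.2.2)⟩ : TwistMor p h G X))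
    (T.inv_comp m.2.1).2
  continuous_dom := continuous_sigma fun ab =>
    (continuous_sigmaMk (σ := fun α : ZpHom p h G => fixed α X) (i := ab.1)).comp continuous_snd
  continuous_cod := TwistMor.continuous_cod
  continuous_one := continuous_sigma fun α =>
    (continuous_sigmaMk (σ := fun ab : ZpHom p h G × ZpHom p h G => T ab.1 ab.2 × fixed ab.1 X)
      (i := (α, α))).comp
      (Continuous.prodMk (f := fun _ => T.one α) (g := fun x : fixed α X => x)
        continuous_const continuous_id)
  continuous_comp := by
    refine TwistMor.continuous_mk ?_ ?_
    · let L := Σ ab : ZpHom p h G × ZpHom p h G, T ab.1 ab.2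
      let c : {q : L × L // q.1.1.2 = q.2.1.1} → L := fun q =>
        ⟨(q.1.1.1.1, q.1.2.1.2), T.comp q.2 q.1.2.2 q.1.1.2⟩
      have hc : Continuous c := continuous_of_discreteTopology
      exact hc.comp (Continuous.subtype_mk
        (f := fun q : {q : TwistMor p h G X × TwistMor p h G X //
          TwistMor.cod q.1 = TwistMor.dom q.2} => (TwistMor.label q.1.1, TwistMor.label q.1.2))
        ((TwistMor.continuous_label.comp (continuous_fst.comp continuous_subtype_val)).prodMk
          (TwistMor.continuous_label.comp (continuous_snd.comp continuous_subtype_val)))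
        (fun q => congrArg Sigma.fst q.2))
    · exact (TwistMor.continuous_pt (p := p) (h := h) (G := G) (X := X)).comp
        (g := fun m : TwistMor p h G X => (m.2.2 : X))
        (f := fun q : {q : TwistMor p h G X × TwistMor p h G X //
          TwistMor.cod q.1 = TwistMor.dom q.2} => q.1.1)
        (continuous_fst.comp continuous_subtype_val)
  continuous_inv := by
    refine TwistMor.continuous_mk ?_ ?_
    · let L := Σ ab : ZpHom p h G × ZpHom p h G, T ab.1 ab.2
      let c : L → L := fun l => ⟨(l.1.2, l.1.1), T.inv l.2⟩
      have hc : Continuous c := continuous_of_discreteTopology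
      exact hc.comp TwistMor.continuous_label
    · have : Continuous fun x : TwistObj p h G X => (x.2 : X) :=
        continuous_sigma fun _ => continuous_subtype_val
      exact this.comp TwistMor.continuous_cod

/-- `Twist_h^{gpd}(X)`: the geometric realization of the nerve of the topological groupoid. -/
def TwistGpd (p : ℕ) [Fact p.Prime] (h : ℕ) (G : Type u) [Group G] [TopologicalSpace G]
    [DiscreteTopology G] (X : Type v) [TopologicalSpace X] [MulAction G X]
    [ContinuousSMul G X] : Type (max u v) :=
  Realization (nerve (twistGroupoid p h G X))

instance : TopologicalSpace (TwistGpd p h G X) :=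
  inferInstanceAs (TopologicalSpace (Realization (nerve (twistGroupoid p h G X))))

end Continuity

end Twist

end

end TwistSpace

/-! An element of `T α β` exists only when `α` and `β` are conjugate, so the groupoid splits over
conjugacy classes. Every object `x` over `α` has a continuous arrow `repArrow` to an object over the
representative of the class, and the full subgroupoid over a representative `α` is the action
groupoid of `T α α` on `X^{im α}`. The realized nerve of that action groupoid is the Borel
construction.

The comparison is explicit. `toGpd` sends a simplex `γ` of `ET(α)` and a point `y` to the chain with
objects `γⱼ⁻¹ y` (`normalChain`). `ofGpd` conjugates a chain by `repArrow`, so that it lies over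
representatives, and reads off its labels. Normal chains correspond exactly to orbits of pairs `(γ,
y)` (`normalChain_smul`, `normalChain_inj`, `eq_normalChain`), so `ofGpd ∘ toGpd` is the identity
and `toGpd ∘ ofGpd` is conjugation by `repArrow`.

Conjugation is homotopic to the identity: a chain `F` and its conjugate `F'` form one chain `F₀ → ⋯
→ Fₙ → F₀' → ⋯ → Fₙ'` on the join `[n] * [n]`, and a point `u` moves in a straight line from its
copy in the first face to its copy in the second. This needs no comparison of the realization of a
product with a product of realizations.

The one topological difficulty is the continuity of `toGpd`: the quotient map onto `ET(α)` has to
remain one after a product with `X^{im α}`, which holds if `X^{im α}` is locally compact. Both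
constructions are `G`-homotopy invariant, so `X` may be replaced by a finite `G`-CW complex, whose
fixed point sets are compact Hausdorff. -/

namespace TwistSpace

open CategoryTheory Opposite

noncomputable section

universe u v w w'

/-! ### Maps out of a realization -/

section Realization

variable {S : SimplicialObject TopCat.{w}}

/-- The class of a point of `Sₙ × Δⁿ`. -/
def Realization.mk (n : SimplexCategory) (x : S.obj (op n))
    (u : stdSimplex ℝ (Fin (n.len + 1))) : Realization S :=
  Quot.mk (RealizationRel S) ⟨n, (x, u)⟩

lemma Realization.glue {m n : SimplexCategory} (θ : m ⟶ n) (x : S.obj (op n))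
    (u : stdSimplex ℝ (Fin (m.len + 1))) :
    Realization.mk m (S.map θ.op x) u = Realization.mk n x (stdSimplex.map θ.toOrderHom u) :=
  Quot.sound (RealizationRel.glue θ x u)

lemma Realization.ind {P : Realization S → Prop} (H : ∀ n x u, P (Realization.mk n x u))
    (z : Realization S) : P z :=
  Quot.ind (fun a => H a.1 a.2.1 a.2.2) z

lemma Realization.isQuotientMap :
    Topology.IsQuotientMap (Quot.mk (RealizationRel S) : PreRealization S → Realization S) :=
  isQuotientMap_quot_mk

lemma Realization.continuous_of_comp_mk {W : Type*} [TopologicalSpace W] {f : Realization S → W}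
    (hf : ∀ n, Continuous fun q : S.obj (op n) × stdSimplex ℝ (Fin (n.len + 1)) =>
      f (Realization.mk n q.1 q.2)) : Continuous f :=
  Realization.isQuotientMap.continuous_iff.mpr (continuous_sigma hf)

lemma Realization.continuous_mk (n : SimplexCategory) :
    Continuous fun q : S.obj (op n) × stdSimplex ℝ (Fin (n.len + 1)) =>
      Realization.mk n q.1 q.2 :=
  continuous_quot_mk.comp (continuous_sigmaMk
    (σ := fun n : SimplexCategory => S.obj (op n) × stdSimplex ℝ (Fin (n.len + 1))))

lemma continuous_prod_sigma {A W ι : Type*} {B : ι → Type*} [TopologicalSpace A]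
    [TopologicalSpace W] [∀ i, TopologicalSpace (B i)] {f : A × (Σ i, B i) → W}
    (hf : ∀ i, Continuous fun q : A × B i => f (q.1, ⟨i, q.2⟩)) : Continuous f := by
  have h : Continuous fun q : (Σ i, B i) × A => f (q.2, q.1) := by
    rw [← (Homeomorph.sigmaProdDistrib (X := B) (Y := A)).symm.comp_continuous_iff']
    exact continuous_sigma fun i => (hf i).comp continuous_swap
  exact h.comp continuous_swap

/-- A product with a locally compact space preserves quotient maps. This serves homotopies, with `A`
the unit interval, and `toGpd`, with `A` a fixed point set. -/
lemma Realization.continuous_of_comp_mk_prod {A W : Type*} [TopologicalSpace A]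
    [LocallyCompactSpace A] [TopologicalSpace W] {f : A × Realization S → W}
    (hf : ∀ n, Continuous fun q : A × (S.obj (op n) × stdSimplex ℝ (Fin (n.len + 1))) =>
      f (q.1, Realization.mk n q.2.1 q.2.2)) : Continuous f :=
  Realization.isQuotientMap.continuous_lift_prod_right (continuous_prod_sigma hf)

end Realization

/-! ### Chains determined by arrows with a common source -/

section Star

variable (𝒢 : TopGroupoid.{w})

namespace TopGroupoid

variable {𝒢}

/-- Since `comp` takes a proof of composability, its factors cannot simply be rewritten. -/
lemma comp_congr {f f' g g' : 𝒢.Mor} (hf : f = f') (hg : g = g') (e : 𝒢.cod f = 𝒢.dom g)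
    (e' : 𝒢.cod f' = 𝒢.dom g') : 𝒢.comp f g e = 𝒢.comp f' g' e' := by
  subst hf hg; rfl

lemma one_comp' {f g : 𝒢.Mor} {x : 𝒢.Obj} (hf : f = 𝒢.one x) (e : 𝒢.cod f = 𝒢.dom g) :
    𝒢.comp f g e = g := by
  subst hf
  obtain rfl : x = 𝒢.dom g := by rw [← e, 𝒢.cod_one]
  exact 𝒢.one_comp g

lemma comp_one' {f g : 𝒢.Mor} {x : 𝒢.Obj} (hg : g = 𝒢.one x) (e : 𝒢.cod f = 𝒢.dom g) :
    𝒢.comp f g e = f := by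
  subst hg
  obtain rfl : x = 𝒢.cod f := by rw [e, 𝒢.dom_one]
  exact 𝒢.comp_one f

lemma inv_comp_cancel (f g : 𝒢.Mor) (e : 𝒢.cod f = 𝒢.dom g) :
    𝒢.comp (𝒢.inv f) (𝒢.comp f g e) (by rw [𝒢.cod_inv, 𝒢.dom_comp]) = g := by
  rw [← 𝒢.assoc (𝒢.inv f) f g (𝒢.cod_inv f) e]
  exact one_comp' (𝒢.inv_comp f) _

lemma comp_inv_cancel (f g : 𝒢.Mor) (e : 𝒢.dom f = 𝒢.dom g) :
    𝒢.comp f (𝒢.comp (𝒢.inv f) g (by rw [𝒢.cod_inv, e])) (by rw [𝒢.dom_comp, 𝒢.dom_inv]) =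
      g := by
  rw [← 𝒢.assoc f (𝒢.inv f) g (𝒢.dom_inv f).symm]
  exact one_comp' (𝒢.comp_inv f) _

/-- `f⁻¹ g`, for arrows with a common source. -/
def div (f g : 𝒢.Mor) (e : 𝒢.dom f = 𝒢.dom g) : 𝒢.Mor :=
  𝒢.comp (𝒢.inv f) g (by rw [𝒢.cod_inv, e])

lemma dom_div (f g : 𝒢.Mor) (e : 𝒢.dom f = 𝒢.dom g) : 𝒢.dom (div f g e) = 𝒢.cod f :=
  (𝒢.dom_comp _ _ _).trans (𝒢.dom_inv f)

lemma cod_div (f g : 𝒢.Mor) (e : 𝒢.dom f = 𝒢.dom g) : 𝒢.cod (div f g e) = 𝒢.cod g :=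
  𝒢.cod_comp _ _ _

lemma div_comp_div (f g k : 𝒢.Mor) (e : 𝒢.dom f = 𝒢.dom g) (e' : 𝒢.dom g = 𝒢.dom k)
    (e'' : 𝒢.cod (div f g e) = 𝒢.dom (div g k e')) :
    𝒢.comp (div f g e) (div g k e') e'' = div f k (e.trans e') := by
  unfold div
  rw [𝒢.assoc _ _ _ _ (by rw [𝒢.dom_comp, 𝒢.dom_inv])]
  exact comp_congr rfl (comp_inv_cancel g k e') _ _

lemma comp_div_comp (m f g : 𝒢.Mor) (e : 𝒢.cod m = 𝒢.dom f) (e' : 𝒢.cod m = 𝒢.dom g) :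
    div (𝒢.comp m f e) (𝒢.comp m g e') (by rw [𝒢.dom_comp, 𝒢.dom_comp]) =
      div f g (e.symm.trans e') := by
  -- `div a b` is the only `c` with `a c = b`; this avoids inverting a composite.
  have h : ∀ a b : 𝒢.Mor, ∀ (hab : 𝒢.dom a = 𝒢.dom b) (c : 𝒢.Mor) (hc : 𝒢.cod a = 𝒢.dom c),
      𝒢.comp a c hc = b → div a b hab = c := by
    rintro a b hab c hc rfl
    exact inv_comp_cancel a c hc
  refine h _ _ _ _ (by rw [𝒢.cod_comp, dom_div]) ?_
  rw [𝒢.assoc _ _ _ e (dom_div _ _ _).symm]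
  exact comp_congr rfl (comp_inv_cancel f g (e.symm.trans e')) _ _

lemma continuous_comp' {Z : Type*} [TopologicalSpace Z] {f g : Z → 𝒢.Mor} (hf : Continuous f)
    (hg : Continuous g) (e : ∀ z, 𝒢.cod (f z) = 𝒢.dom (g z)) :
    Continuous fun z => 𝒢.comp (f z) (g z) (e z) :=
  𝒢.continuous_comp.comp (g := fun q : {q : 𝒢.Mor × 𝒢.Mor // 𝒢.cod q.1 = 𝒢.dom q.2} =>
    𝒢.comp q.1.1 q.1.2 q.2) ((hf.prodMk hg).subtype_mk e)

end TopGroupoid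

open TopGroupoid

variable {𝒢}

namespace NerveSimplex

variable {I J K : Type} [Preorder I] [Preorder J] [Preorder K]

/-- Objects are the sources of the arrows `j ≤ j`, so arrows suffice. -/
lemma ext {F F' : NerveSimplex 𝒢 J} (h : ∀ q, F.1.2 q = F'.1.2 q) : F = F' := by
  refine Subtype.ext (Prod.ext (funext fun j => ?_) (funext h))
  rw [← F.2.1 ⟨(j, j), le_refl j⟩, ← F'.2.1 ⟨(j, j), le_refl j⟩, h]

lemma continuous_ob (j : J) : Continuous fun F : NerveSimplex 𝒢 J => F.1.1 j :=
  (continuous_apply j).comp (continuous_fst.comp continuous_subtype_val)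

lemma continuous_mor (q : {q : J × J // q.1 ≤ q.2}) :
    Continuous fun F : NerveSimplex 𝒢 J => F.1.2 q :=
  (continuous_apply q).comp (continuous_snd.comp continuous_subtype_val)

/-- The chain whose arrow `j ≤ k` is `ρⱼ⁻¹ ρₖ`. -/
def star (ρ : J → 𝒢.Mor) (h : ∀ j k, 𝒢.dom (ρ j) = 𝒢.dom (ρ k)) : NerveSimplex 𝒢 J :=
  ⟨(fun j => 𝒢.cod (ρ j), fun q => div (ρ q.1.1) (ρ q.1.2) (h _ _)),
    fun _ => dom_div _ _ (h _ _), fun _ => cod_div _ _ (h _ _),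
    fun j => 𝒢.inv_comp (ρ j), fun _ _ _ _ _ e => div_comp_div _ _ _ (h _ _) (h _ _) e⟩

lemma continuous_star {Z : Type*} [TopologicalSpace Z] {ρ : Z → J → 𝒢.Mor}
    (hρ : ∀ j, Continuous fun z => ρ z j)
    (h : ∀ z j k, 𝒢.dom (ρ z j) = 𝒢.dom (ρ z k)) :
    Continuous fun z => star (ρ z) (h z) := by
  refine Continuous.subtype_mk (Continuous.prodMk ?_ ?_) _
  · exact continuous_pi fun j => 𝒢.continuous_cod.comp (hρ j)
  · exact continuous_pi fun q =>
      continuous_comp' (𝒢.continuous_inv.comp (hρ q.1.1)) (hρ q.1.2) _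

lemma star_congr {ρ ρ' : J → 𝒢.Mor} (H : ∀ j, ρ j = ρ' j)
    (h : ∀ j k, 𝒢.dom (ρ j) = 𝒢.dom (ρ k)) :
    star ρ h = star ρ' fun j k => by rw [← H, ← H]; exact h j k := by
  obtain rfl := funext H
  rfl

/-- A common first factor cancels in `ρⱼ⁻¹ ρₖ`. This is behind both the descent of `toGpd` to orbits
and the naturality of `twist`. -/
lemma star_precomp (m : 𝒢.Mor) {ρ : J → 𝒢.Mor} (e : ∀ j, 𝒢.cod m = 𝒢.dom (ρ j)) :
    star (fun j => 𝒢.comp m (ρ j) (e j)) (fun j k => by rw [𝒢.dom_comp, 𝒢.dom_comp]) =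
      star ρ fun j k => (e j).symm.trans (e k) :=
  ext fun _ => comp_div_comp _ _ _ _ _

lemma comp_mor (F : NerveSimplex 𝒢 J) {i j k : J} (hij : i ≤ j) (hjk : j ≤ k) :
    𝒢.comp (F.1.2 ⟨(i, j), hij⟩) (F.1.2 ⟨(j, k), hjk⟩) (by rw [F.2.2.1, F.2.1]) =
      F.1.2 ⟨(i, k), hij.trans hjk⟩ :=
  F.2.2.2.2 _ _ _ _ _ _

/-- A chain in a groupoid is determined by its arrows out of the initial vertex. -/
lemma star_bot [OrderBot J] (F : NerveSimplex 𝒢 J) :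
    star (fun j => F.1.2 ⟨(⊥, j), bot_le⟩) (fun j k => by rw [F.2.1, F.2.1]) = F := by
  refine ext fun q => ?_
  obtain ⟨⟨j, k⟩, hjk⟩ := q
  have := inv_comp_cancel (F.1.2 ⟨(⊥, j), bot_le⟩) (F.1.2 ⟨(j, k), hjk⟩)
    (by rw [F.2.2.1, F.2.1])
  exact Eq.trans (comp_congr rfl (F.comp_mor bot_le hjk).symm _ _) this

/-- The chain with objects the targets of `τₖ` at `F (π k)`, obtained from `F` by conjugation. -/
def twist [OrderBot J] (F : NerveSimplex 𝒢 J) (π : K → J) (τ : K → 𝒢.Obj → 𝒢.Mor)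
    (hτ : ∀ k x, 𝒢.dom (τ k x) = x) : NerveSimplex 𝒢 K :=
  star (fun k => 𝒢.comp (F.1.2 ⟨(⊥, π k), bot_le⟩) (τ k (F.1.1 (π k)))
    (by rw [F.2.2.1, hτ])) fun j k => by rw [𝒢.dom_comp, 𝒢.dom_comp, F.2.1, F.2.1]

lemma continuous_twist [OrderBot J] (π : K → J) {τ : K → 𝒢.Obj → 𝒢.Mor}
    (hτ : ∀ k x, 𝒢.dom (τ k x) = x) (hc : ∀ k, Continuous (τ k)) :
    Continuous fun F : NerveSimplex 𝒢 J => twist F π τ hτ :=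
  continuous_star (fun k => continuous_comp' (continuous_mor _)
    ((hc k).comp (continuous_ob (π k))) _) _

lemma twist_congr [OrderBot J] (F : NerveSimplex 𝒢 J) {π π' : K → J}
    {τ τ' : K → 𝒢.Obj → 𝒢.Mor} (hπ : π = π') (h : τ = τ') (hτ : ∀ k x, 𝒢.dom (τ k x) = x)
    (hτ' : ∀ k x, 𝒢.dom (τ' k x) = x) : twist F π τ hτ = twist F π' τ' hτ' := by
  subst hπ h; rfl

lemma twist_eq_self [OrderBot J] (F : NerveSimplex 𝒢 J) {τ : J → 𝒢.Obj → 𝒢.Mor}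
    (hτ : ∀ k x, 𝒢.dom (τ k x) = x) (h : ∀ k, τ k (F.1.1 k) = 𝒢.one (F.1.1 k)) :
    twist F id τ hτ = F := by
  conv_rhs => rw [← star_bot F]
  exact star_congr (fun j => comp_one' (h j) _) _

lemma twist_one [OrderBot J] (F : NerveSimplex 𝒢 J) :
    twist F id (fun _ => 𝒢.one) (fun _ => 𝒢.dom_one) = F :=
  twist_eq_self F _ fun _ => rfl

/-- `θ` need not preserve `⊥`. Moving the base vertex from `⊥` to `θ ⊥` changes all arrows of the
star by the common factor `F(⊥ ≤ θ ⊥)`, which the star ignores. -/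
lemma twist_pull [OrderBot I] [OrderBot J] (θ : I →o J) (F : NerveSimplex 𝒢 J) (π : K → I)
    (τ : K → 𝒢.Obj → 𝒢.Mor) (hτ : ∀ k x, 𝒢.dom (τ k x) = x) :
    twist (pull 𝒢 θ F) π τ hτ = twist F (θ ∘ π) τ hτ := by
  refine (star_precomp (F.1.2 ⟨(⊥, θ ⊥), bot_le⟩) (fun k => ?_)).symm.trans ?_
  · rw [𝒢.dom_comp, F.2.2.1, (pull 𝒢 θ F).2.1]; rfl
  · refine star_congr (fun k => ?_) _
    rw [← 𝒢.assoc _ _ _ (by rw [F.2.2.1, (pull 𝒢 θ F).2.1]; rfl)]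
    exact comp_congr (F.comp_mor bot_le (θ.monotone bot_le)) rfl _ _

end NerveSimplex

end Star

/-! ### Joins of simplices -/

section Join

/-- The flag marking the second copy of `[n]` in the join `[n] * [n] = [2n + 1]`. -/
def joinFlag (n : ℕ) : Fin ((n + 1) + (n + 1)) → Bool :=
  Fin.addCases (fun _ => false) (fun _ => true)

/-- The projection of `[n] * [n]` to `[n]`. -/
def joinProj (n : ℕ) : Fin ((n + 1) + (n + 1)) → Fin (n + 1) := Fin.addCases id id

/-- The inclusion of the first copy of `[n]` into `[n] * [n]`. -/
def joinInl (n : ℕ) : Fin (n + 1) →o Fin ((n + 1) + (n + 1)) :=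
  (Fin.castAddOrderEmb (n + 1)).toOrderHom

/-- The inclusion of the second copy of `[n]` into `[n] * [n]`. -/
def joinInr (n : ℕ) : Fin (n + 1) →o Fin ((n + 1) + (n + 1)) :=
  (Fin.natAddOrderEmb (n + 1)).toOrderHom

/-- `θ * θ`. -/
def joinMap {m n : ℕ} (θ : Fin (m + 1) →o Fin (n + 1)) :
    Fin ((m + 1) + (m + 1)) →o Fin ((n + 1) + (n + 1)) where
  toFun := Fin.addCases (fun i => joinInl n (θ i)) (fun i => joinInr n (θ i))
  monotone' := by
    intro a b
    refine Fin.addCases (fun i => ?_) (fun i => ?_) a <;>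
      refine Fin.addCases (fun j => ?_) (fun j => ?_) b <;> intro hab <;>
      simp only [Fin.addCases_left, Fin.addCases_right]
    · exact (joinInl n).monotone (θ.monotone ((Fin.castAddOrderEmb (m + 1)).le_iff_le.mp hab))
    -- The whole first copy lies below the second.
    · simp only [joinInl, joinInr, Fin.le_def]
      simp
      omega
    -- No element of the second copy lies below one of the first.
    · simp only [Fin.le_def] at hab
      simp at hab
      omega
    · exact (joinInr n).monotone (θ.monotone (by simpa using hab))

variable {m n : ℕ}

lemma joinMap_comp_inl (θ : Fin (m + 1) →o Fin (n + 1)) :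
    joinMap θ ∘ joinInl m = joinInl n ∘ θ :=
  funext fun i => Fin.addCases_left (motive := fun _ => Fin ((n + 1) + (n + 1)))
    (left := fun i => joinInl n (θ i)) (right := fun i => joinInr n (θ i)) i

lemma joinMap_comp_inr (θ : Fin (m + 1) →o Fin (n + 1)) :
    joinMap θ ∘ joinInr m = joinInr n ∘ θ :=
  funext fun i => Fin.addCases_right (motive := fun _ => Fin ((n + 1) + (n + 1)))
    (left := fun i => joinInl n (θ i)) (right := fun i => joinInr n (θ i)) i

lemma joinProj_comp_inl (n : ℕ) : joinProj n ∘ joinInl n = id :=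
  funext fun i => Fin.addCases_left (motive := fun _ => Fin (n + 1)) i

lemma joinProj_comp_inr (n : ℕ) : joinProj n ∘ joinInr n = id :=
  funext fun i => Fin.addCases_right (motive := fun _ => Fin (n + 1)) i

lemma joinFlag_comp_inl (n : ℕ) (i : Fin (n + 1)) : joinFlag n (joinInl n i) = false :=
  Fin.addCases_left (motive := fun _ => Bool) i

lemma joinFlag_comp_inr (n : ℕ) (i : Fin (n + 1)) : joinFlag n (joinInr n i) = true :=
  Fin.addCases_right (motive := fun _ => Bool) i

/-- `joinProj` is not monotone in general, so it is no simplicial operator. It can still index a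
`twist`, because the arrow `Fₙ → F₀'` exists by inverting arrows of `F`. -/
lemma joinProj_comp_map (θ : Fin (m + 1) →o Fin (n + 1)) :
    joinProj n ∘ joinMap θ = θ ∘ joinProj m := by
  funext k
  refine Fin.addCases (fun i => ?_) (fun i => ?_) k
  · exact (congrArg (joinProj n) (congrFun (joinMap_comp_inl θ) i)).trans
      ((congrFun (joinProj_comp_inl n) (θ i)).trans
        (congrArg θ (congrFun (joinProj_comp_inl m) i)).symm)
  · exact (congrArg (joinProj n) (congrFun (joinMap_comp_inr θ) i)).trans
      ((congrFun (joinProj_comp_inr n) (θ i)).trans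
        (congrArg θ (congrFun (joinProj_comp_inr m) i)).symm)

lemma joinFlag_map (θ : Fin (m + 1) →o Fin (n + 1)) (k : Fin ((m + 1) + (m + 1))) :
    joinFlag n (joinMap θ k) = joinFlag m k := by
  refine Fin.addCases (fun i => ?_) (fun i => ?_) k
  · exact (congrArg (joinFlag n) (congrFun (joinMap_comp_inl θ) i)).trans
      ((joinFlag_comp_inl n _).trans (joinFlag_comp_inl m i).symm)
  · exact (congrArg (joinFlag n) (congrFun (joinMap_comp_inr θ) i)).trans
      ((joinFlag_comp_inr n _).trans (joinFlag_comp_inr m i).symm)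

/-- The point dividing the segment from `u`, in the first face of `Δⁿ * Δⁿ`, to `u`, in the
second one, in the ratio `s : 1 - s`. -/
def joinPoint (s : unitInterval) (u : stdSimplex ℝ (Fin (n + 1))) :
    stdSimplex ℝ (Fin ((n + 1) + (n + 1))) :=
  ⟨(1 - s : ℝ) • ⇑(stdSimplex.map (joinInl n) u) + (s : ℝ) • ⇑(stdSimplex.map (joinInr n) u),
    convex_stdSimplex ℝ _ (stdSimplex.map (joinInl n) u).2 (stdSimplex.map (joinInr n) u).2
      (sub_nonneg.mpr s.2.2) s.2.1 (by ring)⟩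

lemma joinPoint_zero (u : stdSimplex ℝ (Fin (n + 1))) :
    joinPoint 0 u = stdSimplex.map (joinInl n) u :=
  Subtype.ext (by simp [joinPoint]; rfl)

lemma joinPoint_one (u : stdSimplex ℝ (Fin (n + 1))) :
    joinPoint 1 u = stdSimplex.map (joinInr n) u :=
  Subtype.ext (by simp [joinPoint]; rfl)

/-- Pushforward of weights is linear, so it commutes with convex combinations. Together with
`joinChain_pull` this makes the homotopy respect the gluing. -/
lemma map_joinPoint (θ : Fin (m + 1) →o Fin (n + 1)) (s : unitInterval)
    (u : stdSimplex ℝ (Fin (m + 1))) :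
    stdSimplex.map (joinMap θ) (joinPoint s u) = joinPoint s (stdSimplex.map θ u) := by
  have hl : stdSimplex.map (joinMap θ) (stdSimplex.map (joinInl m) u) =
      stdSimplex.map (joinInl n) (stdSimplex.map θ u) := by
    rw [stdSimplex.map_comp_apply, stdSimplex.map_comp_apply, joinMap_comp_inl]
  have hr : stdSimplex.map (joinMap θ) (stdSimplex.map (joinInr m) u) =
      stdSimplex.map (joinInr n) (stdSimplex.map θ u) := by
    rw [stdSimplex.map_comp_apply, stdSimplex.map_comp_apply, joinMap_comp_inr]
  refine Subtype.ext ?_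
  change FunOnFinite.linearMap ℝ ℝ (joinMap θ) (_ + _) = _ + _
  rw [map_add, map_smul, map_smul, ← hl, ← hr]
  rfl

lemma continuous_joinPoint :
    Continuous fun q : unitInterval × stdSimplex ℝ (Fin (n + 1)) => joinPoint q.1 q.2 := by
  refine Continuous.subtype_mk ?_ _
  have hl : Continuous fun q : unitInterval × stdSimplex ℝ (Fin (n + 1)) =>
      (⇑(stdSimplex.map (joinInl n) q.2) : _ → ℝ) :=
    continuous_subtype_val.comp ((stdSimplex.continuous_map _).comp continuous_snd)
  have hr : Continuous fun q : unitInterval × stdSimplex ℝ (Fin (n + 1)) =>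
      (⇑(stdSimplex.map (joinInr n) q.2) : _ → ℝ) :=
    continuous_subtype_val.comp ((stdSimplex.continuous_map _).comp continuous_snd)
  fun_prop

end Join

/-! ### Conjugation by a section of the source map -/

section Conjugation

open NerveSimplex

variable {𝒢 : TopGroupoid.{w}} {σ : 𝒢.Obj → 𝒢.Mor} (hσ : ∀ x, 𝒢.dom (σ x) = x)

/-- Conjugation by `σ` on the nerve. -/
def conj (n : SimplexCategory) (F : NerveSimplex 𝒢 (Fin (n.len + 1))) :
    NerveSimplex 𝒢 (Fin (n.len + 1)) :=
  twist F id (fun _ => σ) (fun _ => hσ)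

lemma conj_pull {m n : SimplexCategory} (θ : m ⟶ n) (F : NerveSimplex 𝒢 (Fin (n.len + 1))) :
    conj hσ m (pull 𝒢 θ.toOrderHom F) = pull 𝒢 θ.toOrderHom (conj hσ n F) :=
  twist_pull θ.toOrderHom F id _ _

/-- Conjugation by `σ` on the realization of the nerve. -/
def realizationConj : Realization (nerve 𝒢) → Realization (nerve 𝒢) :=
  Quot.lift (fun a => Realization.mk (S := nerve 𝒢) a.1 (conj hσ a.1 a.2.1) a.2.2) (by
    rintro _ _ ⟨θ, x, u⟩
    exact (congrArg (fun y => Realization.mk (S := nerve 𝒢) _ y u) (conj_pull hσ θ x)).trans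
      (Realization.glue (S := nerve 𝒢) θ (conj hσ _ x) u))

/-- The section `σ` or the section of identities, according to a flag. -/
def flagArrow (σ : 𝒢.Obj → 𝒢.Mor) (b : Bool) : 𝒢.Obj → 𝒢.Mor := if b then σ else 𝒢.one

lemma dom_flagArrow (hσ : ∀ x, 𝒢.dom (σ x) = x) (b : Bool) (x : 𝒢.Obj) :
    𝒢.dom (flagArrow σ b x) = x := by
  cases b
  · exact 𝒢.dom_one x
  · exact hσ x

/-- The chain `F₀ → ⋯ → Fₙ → F₀' → ⋯ → Fₙ'` where `F'` is the conjugate of `F`. -/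
def joinChain (n : ℕ) (F : NerveSimplex 𝒢 (Fin (n + 1))) :
    NerveSimplex 𝒢 (Fin ((n + 1) + (n + 1))) :=
  twist F (joinProj n) (fun k => flagArrow σ (joinFlag n k)) fun _ => dom_flagArrow hσ _

lemma joinChain_pull {m n : ℕ} (θ : Fin (m + 1) →o Fin (n + 1))
    (F : NerveSimplex 𝒢 (Fin (n + 1))) :
    joinChain hσ m (pull 𝒢 θ F) = pull 𝒢 (joinMap θ) (joinChain hσ n F) := by
  refine (twist_pull θ F _ _ _).trans ?_
  -- Restricting a star along its index is definitional: the base vertex of `F` is not involved.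
  refine Eq.trans ?_ (rfl : twist F (joinProj n ∘ joinMap θ)
    (fun k => flagArrow σ (joinFlag n (joinMap θ k))) (fun _ => dom_flagArrow hσ _) = _)
  exact twist_congr F (joinProj_comp_map θ).symm (funext fun k => by rw [joinFlag_map]) _ _

lemma joinChain_inl (n : ℕ) (F : NerveSimplex 𝒢 (Fin (n + 1))) :
    pull 𝒢 (joinInl n) (joinChain hσ n F) = F := by
  refine Eq.trans ?_ (twist_one F)
  refine Eq.trans (rfl : _ = twist F (joinProj n ∘ joinInl n)
    (fun k => flagArrow σ (joinFlag n (joinInl n k))) (fun _ => dom_flagArrow hσ _)) ?_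
  exact twist_congr F (joinProj_comp_inl n)
    (funext fun k => by rw [joinFlag_comp_inl]; rfl) _ _

lemma joinChain_inr (n : ℕ) (F : NerveSimplex 𝒢 (Fin (n + 1))) :
    pull 𝒢 (joinInr n) (joinChain hσ n F) = twist F id (fun _ => σ) (fun _ => hσ) := by
  refine Eq.trans (rfl : _ = twist F (joinProj n ∘ joinInr n)
    (fun k => flagArrow σ (joinFlag n (joinInr n k))) (fun _ => dom_flagArrow hσ _)) ?_
  exact twist_congr F (joinProj_comp_inr n)
    (funext fun k => by rw [joinFlag_comp_inr]; rfl) _ _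

/-- The object `[n] * [n]` of the simplex category. -/
abbrev joinObj (n : SimplexCategory) : SimplexCategory := SimplexCategory.mk (n.len + 1 + n.len)

/-- The straight line homotopy from the identity to the conjugation by `σ`. -/
def conjHomotopyFun (s : unitInterval) : Realization (nerve 𝒢) → Realization (nerve 𝒢) :=
  Quot.lift (fun a => Realization.mk (S := nerve 𝒢) (joinObj a.1)
      (joinChain hσ a.1.len a.2.1) (joinPoint s a.2.2)) (by
    rintro _ _ ⟨θ, x, u⟩
    refine (congrArg (fun y => Realization.mk (S := nerve 𝒢) (joinObj _) y (joinPoint s u))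
      (joinChain_pull hσ θ.toOrderHom x)).trans ?_
    refine (Realization.glue (S := nerve 𝒢)
      (SimplexCategory.Hom.mk (joinMap θ.toOrderHom) : joinObj _ ⟶ joinObj _)
      (joinChain hσ _ x) (joinPoint s u)).trans ?_
    exact congrArg (Realization.mk (S := nerve 𝒢) (joinObj _) (joinChain hσ _ x))
      (map_joinPoint θ.toOrderHom s u))

/-- At time `0` the point lies on the first face of the join, and gluing along that face leaves `F`
itself. -/
lemma conjHomotopyFun_zero (z : Realization (nerve 𝒢)) : conjHomotopyFun hσ 0 z = z := by
  induction z using Realization.ind with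
  | H n x u =>
    refine (congrArg (Realization.mk (S := nerve 𝒢) (joinObj n) (joinChain hσ n.len x))
      (joinPoint_zero u)).trans ?_
    refine (Realization.glue (S := nerve 𝒢)
      (SimplexCategory.Hom.mk (joinInl n.len) : n ⟶ joinObj n) (joinChain hσ _ x) u).symm.trans ?_
    exact congrArg (fun y => Realization.mk (S := nerve 𝒢) n y u) (joinChain_inl hσ n.len x)

lemma conjHomotopyFun_one (z : Realization (nerve 𝒢)) :
    conjHomotopyFun hσ 1 z = realizationConj hσ z := by
  induction z using Realization.ind with
  | H n x u =>
    refine (congrArg (Realization.mk (S := nerve 𝒢) (joinObj n) (joinChain hσ n.len x))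
      (joinPoint_one u)).trans ?_
    refine (Realization.glue (S := nerve 𝒢)
      (SimplexCategory.Hom.mk (joinInr n.len) : n ⟶ joinObj n) (joinChain hσ _ x) u).symm.trans ?_
    exact congrArg (fun y => Realization.mk (S := nerve 𝒢) n y u) (joinChain_inr hσ n.len x)

lemma continuous_conjHomotopyFun (hc : Continuous σ) :
    Continuous fun q : unitInterval × Realization (nerve 𝒢) => conjHomotopyFun hσ q.1 q.2 := by
  refine Realization.continuous_of_comp_mk_prod fun n => ?_
  have hτ : ∀ b, Continuous (flagArrow σ b) := by
    rintro (_ | _)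
    · exact 𝒢.continuous_one
    · exact hc
  have h1 : Continuous (joinChain hσ n.len) :=
    continuous_twist _ (fun _ => dom_flagArrow hσ _) fun _ => hτ _
  exact (Realization.continuous_mk (S := nerve 𝒢) (joinObj n)).comp
    (Continuous.prodMk (h1.comp (continuous_fst.comp continuous_snd))
      (continuous_joinPoint.comp (continuous_fst.prodMk (continuous_snd.comp continuous_snd))))

end Conjugation

/-! ### Functoriality in the `G`-space -/

section Functoriality

variable {p : ℕ} [Fact p.Prime] {h : ℕ} {G : Type u} [Group G] [TopologicalSpace G]
variable {X : Type v} [MulAction G X] {Y : Type v} [MulAction G Y] {Z : Type v} [MulAction G Z]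

/-- The map of fixed point sets induced by an equivariant map. -/
def fixedMap (α : ZpHom p h G) (f : X → Y) (hf : ∀ (g : G) x, f (g • x) = g • f x)
    (x : fixed α X) : fixed α Y :=
  ⟨f x, fun z => by rw [← hf, x.2 z]⟩

lemma fixedMap_act {α β : ZpHom p h G} {f : X → Y} (hf : ∀ (g : G) x, f (g • x) = g • f x)
    (τ : T α β) (x : fixed α X) :
    fixedMap β f hf (T.act τ x) = T.act τ (fixedMap α f hf x) := by
  induction τ using T.ind
  exact Subtype.ext (hf _ _)

/-- The parameter space `A` lets one statement cover single maps (`A = Unit`) and homotopies (`A =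
unitInterval`). -/
lemma continuous_fixedMap [TopologicalSpace X] [TopologicalSpace Y] {A : Type*}
    [TopologicalSpace A] (α : ZpHom p h G) {k : A → X → Y}
    (hk : ∀ a (g : G) x, k a (g • x) = g • k a x)
    (hc : Continuous fun q : A × X => k q.1 q.2) :
    Continuous fun q : A × fixed α X => fixedMap α (k q.1) (hk q.1) q.2 :=
  Continuous.subtype_mk (hc.comp
    (continuous_fst.prodMk (continuous_subtype_val.comp continuous_snd))) _

/-- The map of Borel constructions induced by an equivariant map. -/
def Borel.map {Γ : Type w} [TopologicalSpace Γ] [Group Γ] {A B : Type w'} [TopologicalSpace A]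
    [MulAction Γ A] [TopologicalSpace B] [MulAction Γ B] (f : A → B)
    (hf : ∀ (t : Γ) a, f (t • a) = t • f a) : Borel Γ A → Borel Γ B :=
  Quotient.map' (fun q => (q.1, f q.2)) (by
    rintro _ b ⟨t, rfl⟩
    exact ⟨t, Prod.ext rfl (hf t b.2).symm⟩)

/-- The class of `(e, a)` in `EΓ ×_Γ A`. -/
def Borel.mk {Γ : Type w} [TopologicalSpace Γ] [Group Γ] {A : Type w'} [TopologicalSpace A]
    [MulAction Γ A] (e : E Γ) (a : A) : Borel Γ A :=
  Quotient.mk (MulAction.orbitRel Γ (E Γ × A)) (e, a)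

section Borel

variable {Γ : Type w} [TopologicalSpace Γ] [Group Γ] {A : Type w'} [TopologicalSpace A]
    [MulAction Γ A]

lemma Borel.ind {P : Borel Γ A → Prop} (H : ∀ e a, P (Borel.mk e a)) (z : Borel Γ A) : P z :=
  Quotient.ind (fun q => H q.1 q.2) z

lemma Borel.smul_mk (t : Γ) (e : E Γ) (a : A) :
    Borel.mk (t • e) (t • a) = Borel.mk e a :=
  Quotient.sound (s := MulAction.orbitRel Γ (E Γ × A)) ⟨t, rfl⟩

lemma Borel.isQuotientMap :
    Topology.IsQuotientMap fun q : E Γ × A => (Borel.mk q.1 q.2 : Borel Γ A) :=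
  isQuotientMap_quotient_mk'

end Borel

/-- `Twist_h(f)`. -/
def Twist.map [TopologicalSpace X] [TopologicalSpace Y] (r : ConjClass p h G → ZpHom p h G)
    (f : X → Y) (hf : ∀ (g : G) x, f (g • x) = g • f x) : Twist r X → Twist r Y :=
  fun z => ⟨z.1, Borel.map (fixedMap (r z.1) f hf) (fixedMap_act hf) z.2⟩

lemma Twist.ind [TopologicalSpace X] {r : ConjClass p h G → ZpHom p h G} {P : Twist r X → Prop}
    (H : ∀ c e x, P ⟨c, Borel.mk e x⟩) (z : Twist r X) : P z := by
  obtain ⟨c, z⟩ := z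
  induction z using Borel.ind with
  | H e a => exact H c e a

/-- The composite is a separate `f''` that agrees pointwise, so that the time `0` stage of a
homotopy can take its place. -/
lemma Twist.map_map [TopologicalSpace X] [TopologicalSpace Y] [TopologicalSpace Z]
    (r : ConjClass p h G → ZpHom p h G) {f : X → Y} {f' : Y → Z}
    (hf : ∀ (g : G) x, f (g • x) = g • f x) (hf' : ∀ (g : G) x, f' (g • x) = g • f' x)
    {f'' : X → Z} (hf'' : ∀ (g : G) x, f'' (g • x) = g • f'' x) (H : ∀ x, f' (f x) = f'' x)
    (z : Twist r X) : Twist.map r f' hf' (Twist.map r f hf z) = Twist.map r f'' hf'' z := by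
  obtain rfl : f'' = f' ∘ f := (funext H).symm
  induction z using Twist.ind
  rfl

lemma Twist.map_eq_self [TopologicalSpace X] (r : ConjClass p h G → ZpHom p h G) {f : X → X}
    (hf : ∀ (g : G) x, f (g • x) = g • f x) (H : ∀ x, f x = x) (z : Twist r X) :
    Twist.map r f hf z = z := by
  obtain rfl : f = id := funext H
  induction z using Twist.ind
  rfl

lemma Twist.continuous_map [TopologicalSpace X] [TopologicalSpace Y] {A : Type*}
    [TopologicalSpace A] [LocallyCompactSpace A]
    (r : ConjClass p h G → ZpHom p h G) {k : A → X → Y}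
    (hk : ∀ a (g : G) x, k a (g • x) = g • k a x)
    (hc : Continuous fun q : A × X => k q.1 q.2) :
    Continuous fun q : A × Twist r X => Twist.map r (k q.1) (hk q.1) q.2 := by
  refine continuous_prod_sigma fun c => ?_
  refine Borel.isQuotientMap.continuous_lift_prod_right ?_
  have h1 : Continuous fun q : A × (E (T (r c) (r c)) × fixed (r c) X) =>
      (q.2.1, fixedMap (r c) (k q.1) (hk q.1) q.2.2) :=
    (continuous_fst.comp continuous_snd).prodMk ((continuous_fixedMap (r c) hk hc).comp
      (continuous_fst.prodMk (continuous_snd.comp continuous_snd)))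
  exact (continuous_sigmaMk
    (σ := fun c : ConjClass p h G => Borel (T (r c) (r c)) (fixed (r c) Y)) (i := c)).comp
      (Borel.isQuotientMap.continuous.comp h1)

lemma nonempty_homotopyEquiv_of_family {A B : Type*} [TopologicalSpace A] [TopologicalSpace B]
    {a : A → B} {b : B → A} (ha : Continuous a) (hb : Continuous b)
    {φ : unitInterval → A → A} {ψ : unitInterval → B → B}
    (hφ : Continuous fun q : unitInterval × A => φ q.1 q.2)
    (hψ : Continuous fun q : unitInterval × B => ψ q.1 q.2)
    (φ0 : ∀ x, φ 0 x = b (a x)) (φ1 : ∀ x, φ 1 x = x)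
    (ψ0 : ∀ x, ψ 0 x = a (b x)) (ψ1 : ∀ x, ψ 1 x = x) :
    Nonempty (ContinuousMap.HomotopyEquiv A B) :=
  ⟨⟨⟨a, ha⟩, ⟨b, hb⟩,
    ⟨{ toFun := fun q => φ q.1 q.2, continuous_toFun := hφ, map_zero_left := φ0,
       map_one_left := φ1 }⟩,
    ⟨{ toFun := fun q => ψ q.1 q.2, continuous_toFun := hψ, map_zero_left := ψ0,
       map_one_left := ψ1 }⟩⟩⟩

lemma Twist.nonempty_homotopyEquiv [TopologicalSpace X] [TopologicalSpace Y]
    (r : ConjClass p h G → ZpHom p h G)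
    (H : GHomotopyEquivalent G X Y) :
    Nonempty (ContinuousMap.HomotopyEquiv (Twist r X) (Twist r Y)) := by
  obtain ⟨f, k, F, K, hf, hk, hF, hK⟩ := H
  have cf := (Twist.continuous_map (A := Unit) r (k := fun _ => f) (fun _ => hf)
    (f.continuous.comp continuous_snd)).comp (Continuous.prodMk_right ())
  have ck := (Twist.continuous_map (A := Unit) r (k := fun _ => k) (fun _ => hk)
    (k.continuous.comp continuous_snd)).comp (Continuous.prodMk_right ())
  refine nonempty_homotopyEquiv_of_family cf ck
    (φ := fun s => Twist.map r (fun x => F (s, x)) fun g x => hF g s x)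
    (ψ := fun s => Twist.map r (fun x => K (s, x)) fun g x => hK g s x)
    (Twist.continuous_map r (k := fun s x => F (s, x)) (fun s g x => hF g s x) F.continuous)
    (Twist.continuous_map r (k := fun s x => K (s, x)) (fun s g x => hK g s x) K.continuous)
    (fun x => ?_) (fun x => ?_) (fun x => ?_) (fun x => ?_)
  · exact (Twist.map_map r hf hk _ (fun x => (F.apply_zero x).symm) x).symm
  · exact Twist.map_eq_self r _ F.apply_one x
  · exact (Twist.map_map r hk hf _ (fun x => (K.apply_zero x).symm) x).symm
  · exact Twist.map_eq_self r _ K.apply_one x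

/-- The map of morphism spaces induced by an equivariant map. -/
def TwistMor.map (f : X → Y) (hf : ∀ (g : G) x, f (g • x) = g • f x)
    (m : TwistMor p h G X) : TwistMor p h G Y :=
  ⟨m.1, (m.2.1, fixedMap m.1.1 f hf m.2.2)⟩

/-- The map of object spaces induced by an equivariant map. -/
def TwistObj.map (f : X → Y) (hf : ∀ (g : G) x, f (g • x) = g • f x)
    (x : TwistObj p h G X) : TwistObj p h G Y :=
  ⟨x.1, fixedMap x.1 f hf x.2⟩

lemma TwistMor.cod_map {f : X → Y} (hf : ∀ (g : G) x, f (g • x) = g • f x)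
    (m : TwistMor p h G X) : (m.map f hf).cod = m.cod.map f hf :=
  congrArg (Sigma.mk m.1.2) (fixedMap_act hf m.2.1 m.2.2).symm

variable [DiscreteTopology G] [TopologicalSpace X] [ContinuousSMul G X] [TopologicalSpace Y]
  [ContinuousSMul G Y] [TopologicalSpace Z] [ContinuousSMul G Z]

/-- The map of chains induced by an equivariant map. -/
def chainMap (f : X → Y) (hf : ∀ (g : G) x, f (g • x) = g • f x) {J : Type} [Preorder J]
    (F : NerveSimplex (twistGroupoid p h G X) J) : NerveSimplex (twistGroupoid p h G Y) J :=
  ⟨(fun j => (F.1.1 j).map f hf, fun q => (F.1.2 q).map f hf),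
    fun q => congrArg (TwistObj.map f hf) (F.2.1 q),
    fun q => (TwistMor.cod_map hf (F.1.2 q)).trans (congrArg (TwistObj.map f hf) (F.2.2.1 q)),
    fun j => congrArg (TwistMor.map f hf) (F.2.2.2.1 j),
    fun _ _ _ hij hjk _ => congrArg (TwistMor.map f hf) (F.comp_mor hij hjk)⟩

lemma continuous_chainMap {A : Type*} [TopologicalSpace A] {k : A → X → Y}
    (hk : ∀ a (g : G) x, k a (g • x) = g • k a x)
    (hc : Continuous fun q : A × X => k q.1 q.2) (J : Type) [Preorder J] :
    Continuous fun q : A × NerveSimplex (twistGroupoid p h G X) J =>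
      chainMap (k q.1) (hk q.1) q.2 := by
  -- An equivariant map leaves the discrete label alone and moves only the point.
  have hm : Continuous fun q : A × TwistMor p h G X => q.2.map (k q.1) (hk q.1) :=
    TwistMor.continuous_mk
      (TwistMor.continuous_label.comp
        (continuous_snd : Continuous fun q : A × TwistMor p h G X => q.2) :)
      (hc.comp (g := fun q : A × X => k q.1 q.2)
        (f := fun q : A × TwistMor p h G X => (q.1, (q.2.2.2 : X)))
        (continuous_fst.prodMk (TwistMor.continuous_pt.comp
          (continuous_snd : Continuous fun q : A × TwistMor p h G X => q.2) :)))
  have ho : Continuous fun q : A × TwistObj p h G X => q.2.map (k q.1) (hk q.1) :=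
    continuous_prod_sigma fun α => (continuous_sigmaMk
      (σ := fun α : ZpHom p h G => fixed α Y) (i := α)).comp (continuous_fixedMap α hk hc)
  refine Continuous.subtype_mk (Continuous.prodMk ?_ ?_) _
  · exact continuous_pi fun j =>
      ho.comp (continuous_fst.prodMk ((NerveSimplex.continuous_ob j).comp continuous_snd))
  · exact continuous_pi fun q =>
      hm.comp (continuous_fst.prodMk ((NerveSimplex.continuous_mor q).comp continuous_snd))

/-- `Twist_h^{gpd}(f)`. -/
def TwistGpd.map (f : X → Y) (hf : ∀ (g : G) x, f (g • x) = g • f x) :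
    TwistGpd p h G X → TwistGpd p h G Y :=
  Quot.lift (fun a => Realization.mk (S := nerve (twistGroupoid p h G Y)) a.1
      (chainMap f hf a.2.1) a.2.2) (by
    rintro _ _ ⟨θ, x, u⟩
    exact Realization.glue (S := nerve (twistGroupoid p h G Y)) θ (chainMap f hf x) u)

lemma TwistGpd.continuous_map {A : Type*} [TopologicalSpace A] [LocallyCompactSpace A]
    {k : A → X → Y} (hk : ∀ a (g : G) x, k a (g • x) = g • k a x)
    (hc : Continuous fun q : A × X => k q.1 q.2) :
    Continuous fun q : A × TwistGpd p h G X => TwistGpd.map (k q.1) (hk q.1) q.2 := by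
  refine Realization.continuous_of_comp_mk_prod fun n => ?_
  exact (Realization.continuous_mk (S := nerve (twistGroupoid p h G Y)) n).comp
    (Continuous.prodMk ((continuous_chainMap hk hc (Fin (n.len + 1))).comp
      (continuous_fst.prodMk (continuous_fst.comp continuous_snd)))
      (continuous_snd.comp continuous_snd))

lemma TwistGpd.map_map {f : X → Y} {f' : Y → Z}
    (hf : ∀ (g : G) x, f (g • x) = g • f x) (hf' : ∀ (g : G) x, f' (g • x) = g • f' x)
    {f'' : X → Z} (hf'' : ∀ (g : G) x, f'' (g • x) = g • f'' x) (H : ∀ x, f' (f x) = f'' x)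
    (z : TwistGpd p h G X) :
    TwistGpd.map f' hf' (TwistGpd.map f hf z) = TwistGpd.map f'' hf'' z := by
  obtain rfl : f'' = f' ∘ f := (funext H).symm
  induction z using Realization.ind
  rfl

lemma TwistGpd.map_eq_self {f : X → X} (hf : ∀ (g : G) x, f (g • x) = g • f x)
    (H : ∀ x, f x = x) (z : TwistGpd p h G X) : TwistGpd.map f hf z = z := by
  obtain rfl : f = id := funext H
  induction z using Realization.ind
  rfl

lemma TwistGpd.nonempty_homotopyEquiv (H : GHomotopyEquivalent G X Y) :
    Nonempty (ContinuousMap.HomotopyEquiv (TwistGpd p h G X) (TwistGpd p h G Y)) := by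
  obtain ⟨f, k, F, K, hf, hk, hF, hK⟩ := H
  have cf := (TwistGpd.continuous_map (p := p) (h := h) (A := Unit) (k := fun _ => f)
    (fun _ => hf) (f.continuous.comp continuous_snd)).comp (Continuous.prodMk_right ())
  have ck := (TwistGpd.continuous_map (p := p) (h := h) (A := Unit) (k := fun _ => k)
    (fun _ => hk) (k.continuous.comp continuous_snd)).comp (Continuous.prodMk_right ())
  refine nonempty_homotopyEquiv_of_family cf ck
    (φ := fun s => TwistGpd.map (fun x => F (s, x)) fun g x => hF g s x)
    (ψ := fun s => TwistGpd.map (fun x => K (s, x)) fun g x => hK g s x)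
    (TwistGpd.continuous_map (k := fun s x => F (s, x)) (fun s g x => hF g s x) F.continuous)
    (TwistGpd.continuous_map (k := fun s x => K (s, x)) (fun s g x => hK g s x) K.continuous)
    (fun x => ?_) (fun x => ?_) (fun x => ?_) (fun x => ?_)
  · exact (TwistGpd.map_map hf hk _ (fun x => (F.apply_zero x).symm) x).symm
  · exact TwistGpd.map_eq_self _ F.apply_one x
  · exact (TwistGpd.map_map hk hf _ (fun x => (K.apply_zero x).symm) x).symm
  · exact TwistGpd.map_eq_self _ K.apply_one x

end Functoriality

/-! ### Comparison of the two constructions -/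

section Comparison

open NerveSimplex

variable {p : ℕ} [Fact p.Prime] {h : ℕ} {G : Type u} [Group G] [TopologicalSpace G]

/-! ### Choice of arrows to the representatives of conjugacy classes -/

section Representatives

variable (r : ConjClass p h G → ZpHom p h G)

open Classical in
/-- An element conjugating `α` to the representative of its class, equal to `1` if `α` is that
representative. -/
def repElt (hr : ∀ c, Quotient.mk (conjSetoid p h G) (r c) = c) (α : ZpHom p h G) : G :=
  if r (Quotient.mk (conjSetoid p h G) α) = α then 1
  else (Quotient.exact (s := conjSetoid p h G) (hr (Quotient.mk _ α)).symm).choose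

open Classical in
/-- The element of `T(α)` underlying an arrow over the representative `α`. -/
def labelAt (c : ConjClass p h G)
    (l : Σ ab : ZpHom p h G × ZpHom p h G, T ab.1 ab.2) : T (r c) (r c) :=
  if hl : (r c, r c) = l.1 then
    Eq.ndrec (motive := fun ab => T ab.1 ab.2 → T (r c) (r c)) id hl l.2
  -- The default is never read on chains over `r c`; it makes the function total on a discrete
  -- space, hence continuous.
  else 1

lemma labelAt_mk (c : ConjClass p h G) (τ : T (r c) (r c)) : labelAt r c ⟨(r c, r c), τ⟩ = τ :=
  dif_pos rfl

lemma eq_of_labelAt {X : Type v} [MulAction G X] {c : ConjClass p h G} (m : TwistMor p h G X)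
    (hm : m.1 = (r c, r c))
    {y : fixed (r c) X} (hy : (m.2.2 : X) = y) :
    m = ⟨(r c, r c), (labelAt r c m.label, y)⟩ := by
  obtain ⟨ab, τ, x⟩ := m
  obtain rfl : ab = (r c, r c) := hm
  obtain rfl : x = y := Subtype.ext hy
  exact congrArg (fun τ => (⟨(r c, r c), (τ, x)⟩ : TwistMor p h G X)) (labelAt_mk r c τ).symm

variable {r} (hr : ∀ c, Quotient.mk (conjSetoid p h G) (r c) = c)

lemma repElt_mem (α : ZpHom p h G) :
    repElt r hr α ∈ transporter α (r (Quotient.mk (conjSetoid p h G) α)) := by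
  unfold repElt
  split_ifs with hα
  · intro z
    rw [hα]
    simp
  · exact (Quotient.exact (s := conjSetoid p h G) (hr (Quotient.mk _ α)).symm).choose_spec

/-- This normalisation makes conjugation fix chains over representatives on the nose, so that `ofGpd
∘ toGpd` is equal to the identity. -/
lemma repElt_rep (c : ConjClass p h G) : repElt r hr (r c) = 1 :=
  if_pos (by rw [hr c])

lemma T.class_eq {α β : ZpHom p h G} (τ : T α β) :
    Quotient.mk (conjSetoid p h G) α = Quotient.mk (conjSetoid p h G) β := by
  induction τ using T.ind with
  | H g t => exact Quotient.sound (s := conjSetoid p h G) ⟨g, g.2⟩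

lemma rep_injective (hr : ∀ c, Quotient.mk (conjSetoid p h G) (r c) = c) :
    Function.Injective r := fun c c' e => by
  rw [← hr c, ← hr c', e]

end Representatives

variable {X : Type v} [TopologicalSpace X] [MulAction G X] [DiscreteTopology G]
  [ContinuousSMul G X]
variable {r : ConjClass p h G → ZpHom p h G}
  (hr : ∀ c, Quotient.mk (conjSetoid p h G) (r c) = c)

/-- The arrow from an object to an object over the representative of its class. -/
def repArrow (X : Type v) [TopologicalSpace X] [MulAction G X] [ContinuousSMul G X]
    (x : (twistGroupoid p h G X).Obj) : (twistGroupoid p h G X).Mor :=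
  (⟨(x.1, r (Quotient.mk _ x.1)), (T.mk ⟨repElt r hr x.1, repElt_mem hr x.1⟩ 0, x.2)⟩ :
    TwistMor p h G X)

lemma dom_repArrow (x : (twistGroupoid p h G X).Obj) :
    (twistGroupoid p h G X).dom (repArrow hr X x) = x := rfl

lemma continuous_repArrow : Continuous (repArrow hr X) :=
  continuous_sigma fun α => (continuous_sigmaMk
    (σ := fun ab : ZpHom p h G × ZpHom p h G => T ab.1 ab.2 × fixed ab.1 X)
    (i := (α, r (Quotient.mk _ α)))).comp
      (Continuous.prodMk (f := fun _ => T.mk ⟨repElt r hr α, repElt_mem hr α⟩ 0)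
        (g := fun x : fixed α X => x) continuous_const continuous_id)

lemma repArrow_rep {x : TwistObj p h G X} {c : ConjClass p h G} (hx : x.1 = r c) :
    repArrow hr X x = (twistGroupoid p h G X).one x := by
  obtain ⟨α, y⟩ := x
  obtain rfl : α = r c := hx
  -- The target `r ⟦r c⟧` equals `r c` only propositionally, so it is generalised before
  -- substitution.
  have key : ∀ (β : ZpHom p h G) (g : G) (hg : g ∈ transporter (r c) β), β = r c → g = 1 →
      (⟨(r c, β), (T.mk ⟨g, hg⟩ 0, y)⟩ : TwistMor p h G X) =
        ⟨(r c, r c), (T.one (r c), y)⟩ := by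
    rintro β g hg rfl rfl
    rfl
  exact key _ _ (repElt_mem hr _) (by rw [hr c]) (repElt_rep hr c)

/-- The chain in the action groupoid of `T(α)`, for a representative `α`, given by a simplex of
`ET(α)` and a point. -/
def normalChain (r : ConjClass p h G → ZpHom p h G) (c : ConjClass p h G) {J : Type} [Preorder J]
    (γ : J → T (r c) (r c)) (y : fixed (r c) X) : NerveSimplex (twistGroupoid p h G X) J :=
  star (𝒢 := twistGroupoid p h G X)
    (fun j => (⟨(r c, r c), ((γ j)⁻¹, y)⟩ : TwistMor p h G X)) fun _ _ => rfl

variable {J : Type} [Preorder J]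

/-- The arrow `j ≤ k` has label `γₖ⁻¹ γⱼ` and source `γⱼ⁻¹ y`, both unchanged under `(γ, y) ↦ (tγ,
ty)`. Hence the inverses in `normalChain`. In terms of stars, all arrows acquire the common first
factor `t⁻¹`. -/
lemma normalChain_smul (c : ConjClass p h G) (t : T (r c) (r c)) (γ : J → T (r c) (r c))
    (y : fixed (r c) X) : normalChain r c (fun j => t * γ j) (t • y) = normalChain r c γ y := by
  have e : (twistGroupoid p h G X).cod
      (⟨(r c, r c), (t⁻¹, t • y)⟩ : TwistMor p h G X) = (⟨r c, y⟩ : TwistObj p h G X) :=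
    congrArg (Sigma.mk (r c)) (inv_smul_smul t y)
  refine Eq.trans ?_ (star_precomp (𝒢 := twistGroupoid p h G X)
    (⟨(r c, r c), (t⁻¹, t • y)⟩ : TwistMor p h G X)
    (ρ := fun j => (⟨(r c, r c), ((γ j)⁻¹, y)⟩ : TwistMor p h G X)) fun _ => e)
  refine star_congr (fun j => ?_) _
  exact congrArg (fun τ => (⟨(r c, r c), (τ, t • y)⟩ : TwistMor p h G X)) (mul_inv_rev t (γ j))

/-- The chain remembers `γ_⊥⁻¹ y` and all `γⱼ⁻¹ γ_⊥`, hence `(γ, y)` up to the diagonal action; the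
translating element is `γ'_⊥ γ_⊥⁻¹`. -/
lemma normalChain_inj (hr : ∀ c, Quotient.mk (conjSetoid p h G) (r c) = c)
    [OrderBot J] {c c' : ConjClass p h G} {γ : J → T (r c) (r c)}
    {γ' : J → T (r c') (r c')} {y : fixed (r c) X} {y' : fixed (r c') X}
    (H : normalChain r c γ y = normalChain r c' γ' y') (n : SimplexCategory)
    (θ : Fin (n.len + 1) → J) (u : stdSimplex ℝ (Fin (n.len + 1))) :
    (⟨c, Borel.mk (Realization.mk (S := simplicialE _) n (γ ∘ θ) u) y⟩ : Twist r X) =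
      ⟨c', Borel.mk (Realization.mk (S := simplicialE _) n (γ' ∘ θ) u) y'⟩ := by
  have h0 : (⟨r c, (γ ⊥)⁻¹ • y⟩ : TwistObj p h G X) = ⟨r c', (γ' ⊥)⁻¹ • y'⟩ :=
    congrArg (fun F => F.1.1 ⊥) H
  obtain rfl : c = c' := rep_injective hr (congrArg Sigma.fst h0)
  have h1 : (γ ⊥)⁻¹ • y = (γ' ⊥)⁻¹ • y' := eq_of_heq (Sigma.mk.inj h0).2
  have h2 : ∀ j, (γ j)⁻¹ * ((γ ⊥)⁻¹)⁻¹ = (γ' j)⁻¹ * ((γ' ⊥)⁻¹)⁻¹ := fun j => by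
    have : (⟨(r c, r c), ((γ j)⁻¹ * ((γ ⊥)⁻¹)⁻¹, (γ ⊥)⁻¹ • y)⟩ : TwistMor p h G X) =
        ⟨(r c, r c), ((γ' j)⁻¹ * ((γ' ⊥)⁻¹)⁻¹, (γ' ⊥)⁻¹ • y')⟩ :=
      congrArg (fun F => F.1.2 ⟨(⊥, j), bot_le⟩) H
    exact congrArg Prod.fst (eq_of_heq (Sigma.mk.inj this).2)
  refine congrArg (Sigma.mk c) ?_
  have hy : (γ' ⊥ * (γ ⊥)⁻¹) • y = y' := by rw [mul_smul, h1, smul_inv_smul]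
  have hγ : (fun i => (γ' ⊥ * (γ ⊥)⁻¹) * γ (θ i)) = γ' ∘ θ := by
    funext i
    have := congrArg (·⁻¹) (h2 (θ i))
    simp only [mul_inv_rev, inv_inv] at this
    rw [mul_assoc, this, Function.comp_apply, mul_inv_cancel_left]
  refine (Borel.smul_mk (γ' ⊥ * (γ ⊥)⁻¹) _ y).symm.trans ?_
  exact congrArg₂ Borel.mk (congrArg (fun f : Fin (n.len + 1) → T (r c) (r c) =>
    (Realization.mk (S := simplicialE (T (r c) (r c))) n f u : E (T (r c) (r c)))) hγ) hy

/-! #### The map from the Borel constructions to the groupoid -/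

/-- `([γ, u], y) ↦ [normalChain γ y, u]`. -/
def fromBorelAux (r : ConjClass p h G → ZpHom p h G) (c : ConjClass p h G)
    (e : E (T (r c) (r c))) (y : fixed (r c) X) : TwistGpd p h G X :=
  Quot.lift (fun a : PreRealization (simplicialE (T (r c) (r c))) =>
    Realization.mk (S := nerve (twistGroupoid p h G X)) a.1
      (normalChain r c (J := Fin (a.1.len + 1)) a.2.1 y) a.2.2) (by
      rintro _ _ ⟨θ, x, u⟩
      rename_i m n
      exact Realization.glue (S := nerve (twistGroupoid p h G X)) θ
        (normalChain r c (J := Fin (n.len + 1)) x y) u) e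

lemma fromBorelAux_smul (c : ConjClass p h G) (t : T (r c) (r c)) (e : E (T (r c) (r c)))
    (y : fixed (r c) X) : fromBorelAux r c (t • e) (t • y) = fromBorelAux r c e y := by
  induction e using Realization.ind with
  | H n x u =>
    exact congrArg (fun F => Realization.mk (S := nerve (twistGroupoid p h G X)) n F u)
      (normalChain_smul c t (J := Fin (n.len + 1)) x y)

/-- The comparison map from `Twist_h(X)` to `Twist_h^{gpd}(X)`. -/
def toGpd (r : ConjClass p h G → ZpHom p h G) (z : Twist r X) : TwistGpd p h G X :=
  Quotient.lift (s := MulAction.orbitRel (T (r z.1) (r z.1)) _)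
    (fun q : E (T (r z.1) (r z.1)) × fixed (r z.1) X => fromBorelAux r z.1 q.1 q.2) (by
      rintro _ b ⟨t, rfl⟩
      exact fromBorelAux_smul z.1 t b.1 b.2) z.2

lemma continuous_normalChain (c : ConjClass p h G) :
    Continuous fun q : (J → T (r c) (r c)) × fixed (r c) X => normalChain r c q.1 q.2 := by
  refine continuous_star (𝒢 := twistGroupoid p h G X)
    (ρ := fun (q : (J → T (r c) (r c)) × fixed (r c) X) j =>
      (⟨(r c, r c), ((q.1 j)⁻¹, q.2)⟩ : TwistMor p h G X)) (fun j => ?_) _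
  have hi : Continuous fun τ : T (r c) (r c) => τ⁻¹ := continuous_of_discreteTopology
  exact (continuous_sigmaMk
    (σ := fun ab : ZpHom p h G × ZpHom p h G => T ab.1 ab.2 × fixed ab.1 X)
    (i := (r c, r c))).comp
      ((hi.comp ((continuous_apply j).comp continuous_fst)).prodMk continuous_snd)

lemma continuous_toGpd (hX : ∀ α : ZpHom p h G, LocallyCompactSpace (fixed α X)) :
    Continuous (toGpd r : Twist r X → TwistGpd p h G X) := by
  refine continuous_sigma fun c => ?_
  refine Borel.isQuotientMap.continuous_iff.mpr ?_
  -- Local compactness of the fixed point set enters here, to test continuity simplex by simplex on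
  -- `ET(α)`.
  have key : Continuous fun q : fixed (r c) X × E (T (r c) (r c)) =>
      fromBorelAux r c q.2 q.1 := by
    refine Realization.continuous_of_comp_mk_prod fun n => ?_
    exact (Realization.continuous_mk (S := nerve (twistGroupoid p h G X)) n).comp
      (Continuous.prodMk ((continuous_normalChain (J := Fin (n.len + 1)) c).comp
        ((continuous_fst.comp continuous_snd).prodMk continuous_fst))
        (continuous_snd.comp continuous_snd))
  exact key.comp continuous_swap

/-! #### The map from the groupoid to the Borel constructions -/

/-- The simplex of `ET(α)` underlying a chain over the representative `α`. -/
def chainLabels [OrderBot J] (r : ConjClass p h G → ZpHom p h G) (c : ConjClass p h G)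
    (F : NerveSimplex (twistGroupoid p h G X) J) (j : J) : T (r c) (r c) :=
  (labelAt r c (TwistMor.label (F.1.2 ⟨(⊥, j), bot_le⟩)))⁻¹

/-- The initial point of a chain over the representative `α`. -/
def chainPoint [OrderBot J] {c : ConjClass p h G} (F : NerveSimplex (twistGroupoid p h G X) J)
    (hF : ∀ j, Sigma.fst (F.1.1 j) = r c) : fixed (r c) X :=
  ⟨(Sigma.snd (F.1.1 ⊥) : fixed _ X), by rw [← hF ⊥]; exact (Sigma.snd (F.1.1 ⊥)).2⟩

/-- By `star_bot` the chain is the star of its arrows out of `⊥`, all of which start at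
`chainPoint`; their inverted labels serve as `γ`. -/
lemma eq_normalChain [OrderBot J] {c : ConjClass p h G}
    (F : NerveSimplex (twistGroupoid p h G X) J) (hF : ∀ j, Sigma.fst (F.1.1 j) = r c) :
    F = normalChain r c (chainLabels r c F) (chainPoint F hF) := by
  conv_lhs => rw [← star_bot F]
  refine star_congr (fun j => ?_) _
  have hd : TwistMor.dom (F.1.2 ⟨(⊥, j), bot_le⟩) = F.1.1 ⊥ := F.2.1 _
  have hc : TwistMor.cod (F.1.2 ⟨(⊥, j), bot_le⟩) = F.1.1 j := F.2.2.1 _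
  refine (eq_of_labelAt r (y := chainPoint F hF) _ (Prod.ext ?_ ?_) ?_).trans ?_
  · exact (congrArg Sigma.fst hd).trans (hF ⊥)
  · exact (congrArg Sigma.fst hc).trans (hF j)
  · exact congrArg (fun x : TwistObj p h G X => (x.2 : X)) hd
  · exact congrArg (fun τ => (⟨(r c, r c), (τ, chainPoint F hF)⟩ : TwistMor p h G X))
      (inv_inv _).symm

/-- The conjugacy class over which a chain lies. -/
def chainClass [OrderBot J] (F : NerveSimplex (twistGroupoid p h G X) J) : ConjClass p h G :=
  Quotient.mk _ (Sigma.fst (F.1.1 ⊥))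

/-- The conjugacy class is constant along a chain, by `T.class_eq`, so every vertex is carried to
the same representative. -/
lemma conj_label (n : SimplexCategory)
    (F : NerveSimplex (twistGroupoid p h G X) (Fin (n.len + 1))) {c : ConjClass p h G}
    (hc : chainClass F = c) (j : Fin (n.len + 1)) :
    Sigma.fst ((conj (dom_repArrow hr) n F).1.1 j) = r c := by
  have hd : TwistMor.dom (F.1.2 ⟨(⊥, j), bot_le⟩) = F.1.1 ⊥ := F.2.1 _
  have hcod : TwistMor.cod (F.1.2 ⟨(⊥, j), bot_le⟩) = F.1.1 j := F.2.2.1 _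
  have h1 : Quotient.mk (conjSetoid p h G) (Sigma.fst (F.1.1 j)) = c := by
    rw [← hc, chainClass, ← hd, ← hcod]
    exact (T.class_eq (Sigma.snd (F.1.2 ⟨(⊥, j), bot_le⟩) : _ × _).1).symm
  exact congrArg r h1

lemma conj_normalChain (n : SimplexCategory) (c : ConjClass p h G)
    (γ : Fin (n.len + 1) → T (r c) (r c)) (y : fixed (r c) X) :
    conj (dom_repArrow hr) n (normalChain r c γ y) = normalChain r c γ y :=
  twist_eq_self _ _ fun _ => repArrow_rep hr rfl

/-- The point of `Twist_h(X)` defined by a chain over the class `c` and a point of a simplex. -/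
def ofChain (n : SimplexCategory) (c : ConjClass p h G)
    (F : NerveSimplex (twistGroupoid p h G X) (Fin (n.len + 1))) (hc : chainClass F = c)
    (u : stdSimplex ℝ (Fin (n.len + 1))) : Twist r X :=
  ⟨c, Borel.mk (Realization.mk (S := simplicialE (T (r c) (r c))) n
    (chainLabels r c (conj (dom_repArrow hr) n F)) u)
    (chainPoint (conj (dom_repArrow hr) n F) (conj_label hr n F hc))⟩

/-- The class is a free argument of `ofChain` so that it can be held fixed on an open set. -/
lemma ofChain_congr (n : SimplexCategory) {c c' : ConjClass p h G}
    (F : NerveSimplex (twistGroupoid p h G X) (Fin (n.len + 1))) (hc : chainClass F = c)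
    (hc' : chainClass F = c') (u : stdSimplex ℝ (Fin (n.len + 1))) :
    ofChain hr n c F hc u = ofChain hr n c' F hc' u := by
  subst hc hc'; rfl

/-- Any normal form of the conjugated chain computes the same point, not just the one read off at
`⊥`. -/
lemma ofChain_eq (n : SimplexCategory)
    (F : NerveSimplex (twistGroupoid p h G X) (Fin (n.len + 1)))
    (u : stdSimplex ℝ (Fin (n.len + 1))) {c : ConjClass p h G}
    {γ : Fin (n.len + 1) → T (r c) (r c)} {y : fixed (r c) X}
    (H : conj (dom_repArrow hr) n F = normalChain r c γ y) :
    ofChain hr n (chainClass F) F rfl u =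
      ⟨c, Borel.mk (Realization.mk (S := simplicialE (T (r c) (r c))) n γ u) y⟩ :=
  normalChain_inj hr ((eq_normalChain _ (conj_label hr n F rfl)).symm.trans H) n id u

/-- The comparison map from `Twist_h^{gpd}(X)` to `Twist_h(X)`. -/
def ofGpd : TwistGpd p h G X → Twist r X :=
  Quot.lift (fun a => ofChain hr a.1 (chainClass (J := Fin (a.1.len + 1)) a.2.1) a.2.1 rfl
    a.2.2) (by
    rintro _ _ ⟨θ, F, u⟩
    rename_i m n
    -- The pullback of a normal chain is the normal chain of `γ ∘ θ`. It need not be the form based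
    -- at the new `⊥`, and `ofChain_eq` absorbs the difference.
    have H := eq_normalChain _ (conj_label hr n F rfl)
    refine (ofChain_eq hr m (pull _ θ.toOrderHom F) u
      ((conj_pull _ θ F).trans (congrArg (pull _ θ.toOrderHom) H))).trans ?_
    exact congrArg (fun e => (⟨_, Borel.mk e _⟩ : Twist r X))
      (Realization.glue (S := simplicialE (T (r (chainClass (J := Fin (n.len + 1)) F))
        (r (chainClass (J := Fin (n.len + 1)) F)))) θ
        (chainLabels r _ (conj (dom_repArrow hr) n F)) u))

lemma continuous_conj {𝒢 : TopGroupoid.{w}} {σ : 𝒢.Obj → 𝒢.Mor} (hσ : ∀ x, 𝒢.dom (σ x) = x)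
    (hc : Continuous σ) (n : SimplexCategory) : Continuous (conj hσ n) :=
  continuous_twist _ (fun _ => hσ) fun _ => hc

lemma continuous_ofGpd : Continuous (ofGpd hr : TwistGpd p h G X → Twist r X) := by
  refine Realization.continuous_of_comp_mk fun n => ?_
  change Continuous fun q : NerveSimplex (twistGroupoid p h G X) (Fin (n.len + 1)) ×
    stdSimplex ℝ (Fin (n.len + 1)) => ofChain hr n (chainClass q.1) q.1 rfl q.2
  rw [continuous_iff_continuousAt]
  intro q₀
  set c := chainClass q₀.1 with hc₀
  -- The class depends only on the component of the initial vertex, so it is locally constant, and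
  -- continuity may be checked with the class fixed.
  have hU : IsOpen {q : NerveSimplex (twistGroupoid p h G X) (Fin (n.len + 1)) ×
      stdSimplex ℝ (Fin (n.len + 1)) | chainClass q.1 = c} := by
    have hV : IsOpen {x : TwistObj p h G X | Quotient.mk (conjSetoid p h G) x.1 = c} :=
      isOpen_sigma_iff.mpr fun α =>
        (isOpen_const : IsOpen {_x : fixed α X | Quotient.mk (conjSetoid p h G) α = c})
    exact hV.preimage ((continuous_ob (𝒢 := twistGroupoid p h G X) ⊥).comp continuous_fst)
  rw [← hU.isOpenEmbedding_subtypeVal.continuousAt_iff (x := ⟨q₀, rfl⟩)]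
  refine Continuous.continuousAt ?_
  let U := {q : NerveSimplex (twistGroupoid p h G X) (Fin (n.len + 1)) ×
    stdSimplex ℝ (Fin (n.len + 1)) // chainClass q.1 = c}
  have hconj : Continuous fun q : U => conj (dom_repArrow hr) n q.1.1 :=
    (continuous_conj _ (continuous_repArrow hr) n).comp
      (continuous_fst.comp continuous_subtype_val)
  have hlab : Continuous fun q : U => chainLabels r c (conj (dom_repArrow hr) n q.1.1) := by
    refine continuous_pi fun j => ?_
    have hl : Continuous fun l => (labelAt r c l)⁻¹ := continuous_of_discreteTopology
    exact hl.comp (TwistMor.continuous_label.comp ((continuous_mor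
      (𝒢 := twistGroupoid p h G X) ⟨(⊥, j), bot_le⟩).comp hconj))
  have hpt : Continuous fun q : U =>
      chainPoint (conj (dom_repArrow hr) n q.1.1) (conj_label hr n q.1.1 q.2) := by
    have hx : Continuous fun x : TwistObj p h G X => (x.2 : X) :=
      continuous_sigma fun _ => continuous_subtype_val
    exact Continuous.subtype_mk
      (hx.comp ((continuous_ob (𝒢 := twistGroupoid p h G X) ⊥).comp hconj)) _
  have he : Continuous fun q : U => Realization.mk (S := simplicialE (T (r c) (r c))) n
      (chainLabels r c (conj (dom_repArrow hr) n q.1.1)) q.1.2 :=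
    (Realization.continuous_mk (S := simplicialE (T (r c) (r c))) n).comp
      (hlab.prodMk (continuous_snd.comp continuous_subtype_val))
  have hs : Continuous fun q : U => ofChain hr n c q.1.1 q.2 q.1.2 :=
    (continuous_sigmaMk
      (σ := fun c : ConjClass p h G => Borel (T (r c) (r c)) (fixed (r c) X)) (i := c)).comp
        (Borel.isQuotientMap.continuous.comp (he.prodMk hpt))
  exact hs.congr fun q => ofChain_congr hr n q.1.1 _ rfl _

lemma ofGpd_toGpd (z : Twist r X) : ofGpd hr (toGpd r z) = z := by
  induction z using Twist.ind with
  | H c e y =>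
    induction e using Realization.ind with
    | H n γ u =>
      exact ofChain_eq hr n (normalChain r c (J := Fin (n.len + 1)) γ y) u
        (conj_normalChain hr n c γ y)

lemma toGpd_ofGpd (z : TwistGpd p h G X) :
    toGpd r (ofGpd hr z) = realizationConj (dom_repArrow hr) z := by
  induction z using Realization.ind with
  | H n F u =>
    exact congrArg (fun F' => Realization.mk (S := nerve (twistGroupoid p h G X)) n F' u)
      (eq_normalChain _ (conj_label hr n F rfl)).symm

lemma nonempty_homotopyEquiv_twistGpd (hr : ∀ c, Quotient.mk (conjSetoid p h G) (r c) = c)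
    (hX : ∀ α : ZpHom p h G, LocallyCompactSpace (fixed α X)) :
    Nonempty (ContinuousMap.HomotopyEquiv (Twist r X) (TwistGpd p h G X)) :=
  nonempty_homotopyEquiv_of_family (continuous_toGpd hX) (continuous_ofGpd hr)
    (φ := fun _ z => z)
    -- Time is reversed, since `conjHomotopyFun` starts at the identity.
    (ψ := fun s => conjHomotopyFun (dom_repArrow hr) (unitInterval.symm s)) continuous_snd
    ((continuous_conjHomotopyFun (dom_repArrow hr) (continuous_repArrow hr)).comp
      ((unitInterval.continuous_symm.comp continuous_fst).prodMk continuous_snd))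
    (fun z => (ofGpd_toGpd hr z).symm) (fun _ => rfl)
    (fun z => by
      rw [unitInterval.symm_zero, toGpd_ofGpd]
      exact conjHomotopyFun_one _ z)
    (fun z => by
      rw [unitInterval.symm_one]
      exact conjHomotopyFun_zero _ z)

end Comparison

/-! ### Finite `G`-CW complexes -/

/-- The space is a finite union of compact closed cells. -/
lemma IsFiniteGCWComplex.compactSpace {G : Type u} [Group G] {Y : Type v} [TopologicalSpace Y]
    [MulAction G Y] (hY : IsFiniteGCWComplex G Y) : CompactSpace Y := by
  obtain ⟨_, -, C, hfin, -, -⟩ := hY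
  have hu : (⋃ q : Σ n, Topology.RelCWComplex.cell (Set.univ : Set Y) n,
      Topology.RelCWComplex.closedCell q.1 q.2) = Set.univ := by
    rw [Set.iUnion_sigma]
    exact Topology.CWComplex.union
  refine ⟨hu ▸ isCompact_iUnion fun q => Topology.RelCWComplex.isCompact_closedCell⟩

lemma isClosed_fixed {p : ℕ} [Fact p.Prime] {h : ℕ} {G : Type u} [Group G] [TopologicalSpace G]
    {Y : Type v} [TopologicalSpace Y] [T2Space Y] [MulAction G Y]
    (hc : ∀ g : G, Continuous fun y : Y => g • y) (α : ZpHom p h G) : IsClosed (fixed α Y) := by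
  have : fixed α Y = ⋂ z, {y | α z • y = y} := by ext; simp [fixed]
  rw [this]
  exact isClosed_iInter fun z => isClosed_eq (hc _) continuous_id

end

end TwistSpace

/-! ### Reduction to a finite `G`-CW complex -/

theorem mainTheorem6 (p : ℕ) [Fact p.Prime] (h : ℕ)
    (G : Type*) [Group G] [Finite G] [TopologicalSpace G] [DiscreteTopology G]
    (X : Type*) [TopologicalSpace X] [MulAction G X] [ContinuousSMul G X]
    (hX : TwistSpace.IsFiniteGSpace G X)
    (r : TwistSpace.ConjClass p h G → TwistSpace.ZpHom p h G)
    (hr : ∀ c, Quotient.mk (TwistSpace.conjSetoid p h G) (r c) = c) :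
    Nonempty (ContinuousMap.HomotopyEquiv (TwistSpace.Twist r X)
      (TwistSpace.TwistGpd p h G X)) := by
  obtain ⟨Y, _, _, hY, hXY⟩ := hX
  have := hY.compactSpace
  obtain ⟨_, hc, -⟩ := hY
  have : ContinuousSMul G Y := ⟨continuous_prod_of_discrete_left.mpr hc⟩
  obtain ⟨e₁⟩ := TwistSpace.Twist.nonempty_homotopyEquiv r hXY
  -- Fixed point sets are closed in the compact Hausdorff space `Y`, hence locally compact.
  obtain ⟨e₂⟩ := TwistSpace.nonempty_homotopyEquiv_twistGpd (X := Y) hr fun α =>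
    (TwistSpace.isClosed_fixed hc α).isClosedEmbedding_subtypeVal.locallyCompactSpace
  obtain ⟨e₃⟩ := TwistSpace.TwistGpd.nonempty_homotopyEquiv (p := p) (h := h) hXY
  exact ⟨(e₁.trans e₂).trans e₃.symm⟩
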